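/- Let $d\ge 1$, $\varphi\in\mathbb R^d$, and let $(Y_t)_{t\in\mathbb Z}$ be a centered stationary AR$(d)$ process with Gaussian innovations, $Y_t=\sum_{k=1}^d\varphi_kY_{t-k}+Z_t$ for $t\in\mathbb Z$, where $(Z_t)_{t\in\mathbb Z}$ are i.i.d. $\mathcal N(0,1)$ and the polynomial $1-\sum_{k=1}^d\varphi_kz^k$ has no complex root of modulus at most $1$. Put $X_t=(Y_{t-1},\dots,Y_{t-d})$ and, for some $n\ge d$, $\mathcal F_t=\sigma(Y_{-(n-1)},\dots,Y_t)$. For each $t\ge1$ let $\widehat\varphi_t$ be an $\mathcal F_{t-1}$-measurable estimator with values in $\mathbb R^d$. Let $\Phi$ be the standard normal c.d.f. and let $$\mathcal C_t(x,q)=\Big[\langle\widehat\varphi_t,x\rangle\pm\Phi^{-1}\big(\tfrac{q+1}{2}\big)\Big]\quad(0<q<1),$$ with $\mathcal C_t(x,q)=\{\langle\widehat\varphi_t,x\rangle\}$ if $q\le 0$ and $\mathcal C_t(x,q)=\mathbb R$ if $q\ge1$. Let $\alpha\in(0,1)$, $c>0$, $\beta\in(0,1)$, $\gamma_j=cj^{-\beta}$,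 $q_1\in[0,1]$, and consider the OnlineSCI threshold sequence with no selection (every time point is selected), i.e. for $t\ge1$ $$q_{t+1}=q_t+\gamma_t\big(\mathbf 1\{Y_t\notin\mathcal C_t(X_t,q_t)\}\mathbf 1\{q_t\ge0\}+\mathbf 1\{q_t<0\}-\alpha\big).$$ Its instantaneous error rate is $\mathrm{IER}_t=\mathbb P\big(Y_t\notin\mathcal C_t(X_t,q_t)\mid\mathcal F_{t-1}\big)$. Let $$\rho(t)=\begin{cases}(\log t)^{1/2}t^{-\beta/3}&\text{if }\beta\in(1/2,3/4),\\(\log t)^{1/2}t^{1/2-\beta}+t^{\beta-1}&\text{if }\beta\in[3/4,1).\end{cases}$$ (1) In-probability rate. Suppose $\beta>1/2$ and that for some constant $C_1>0$ and all $t$ large enough $$\mathbb P\Big(\mathbb E\big[|\langle\widehat\varphi_t-\varphi,X_t\rangle|\,\big|\,\mathcal F_{t-1}\big]\ge C_1(\log t)^{3/2}t^{-1/2}\Big)\le\frac{3}{\pi^2t^3}.$$ Then there exist $T_0\ge1$ and $C_0>0$ (depending on everything but $t$) such that for all $t\ge T_0$ $$\mathbb P\Big(|\mathrm{IER}_t-\alpha|+|q_t-(1-\alpha)|\le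 C_0\big(\rho(t)+(\log t)^{3/2}t^{-1/2}\big)\Big)\ge1-\frac1t.$$ (2) In-expectation rate. Suppose $\beta>1/2$ and that for some constant $C_1>0$ and all $t$ large enough $\mathbb E\big[\langle\widehat\varphi_t-\varphi,X_t\rangle^2\big]\le C_1t^{-1}$. Then there exist $T_0\ge1$ and $C_0>0$ (depending on everything but $t$) such that for all $t\ge T_0$ $$\Big(\mathbb E\big[|\mathrm{IER}_t-\alpha|\,\mathbf 1\{q_t\in[0,1]\}\big]\Big)^2+\mathbb E\big[(q_t-(1-\alpha))^2\big]\le C_0\,t^{-\beta+1/2}.$$ -/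

import Mathlib

open MeasureTheory ProbabilityTheory Filter Topology
open scoped ENNReal

noncomputable section

namespace OnlineSCI

/-! ### The OnlineSCI procedure (pathwise) -/

/-- Coverage error: `1` if `y ∉ C` and `0` if `y ∈ C`. -/
def coverageErr {𝒴 : Type*} (y : 𝒴) (C : Set 𝒴) : ℝ :=
  Set.indicator Cᶜ (fun _ => (1 : ℝ)) y

/-- Reaction function: the error if `q ≥ 0`, and `1` if `q < 0`. -/
def react {𝒴 : Type*} (err : 𝒴 → Set 𝒴 → ℝ) (y : 𝒴) (C : Set 𝒴) (q : ℝ) : ℝ :=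
  err y C * (if 0 ≤ q then 1 else 0) + (if q < 0 then 1 else 0)

/-- The pair `(q_t, J(t))` along the data `(x_t, y_t)_{t ≥ 1}`, for selection rules `S`, prediction
set rules `C`, steps `γ`, level `α` and starting point `q₁`:
`q_{t+1} = q_t + γ_{J(t)} (react_t(y_t, C_t(x_t, q_t), q_t) - α) S_t(x_t, q_t)` and
`J(t+1) = J(t) + S_t(x_t, q_t)`, with `J(1) = 1`. Time starts at `t = 1`; the value at `t = 0`
is not used. -/
def state {𝒳 𝒴 : Type*} (err : ℕ → 𝒴 → Set 𝒴 → ℝ) (γ : ℕ → ℝ) (α q₁ : ℝ)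
    (S : ℕ → 𝒳 → ℝ → Bool) (C : ℕ → 𝒳 → ℝ → Set 𝒴) (x : ℕ → 𝒳) (y : ℕ → 𝒴) : ℕ → ℝ × ℕ
  | 0 => (q₁, 1)
  | 1 => (q₁, 1)
  | t + 2 =>
    let p := state err γ α q₁ S C x y (t + 1)
    let s : ℕ := (S (t + 1) (x (t + 1)) p.1).toNat
    (p.1 + γ p.2 *
        (react (err (t + 1)) (y (t + 1)) (C (t + 1) (x (t + 1)) p.1) p.1 - α) * (s : ℝ),
      p.2 + s)

/-- The threshold `q_t`. -/
def threshold {𝒳 𝒴 : Type*} (err : ℕ → 𝒴 → Set 𝒴 → ℝ) (γ : ℕ → ℝ) (α q₁ : ℝ)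
    (S : ℕ → 𝒳 → ℝ → Bool) (C : ℕ → 𝒳 → ℝ → Set 𝒴) (x : ℕ → 𝒳) (y : ℕ → 𝒴) (t : ℕ) : ℝ :=
  (state err γ α q₁ S C x y t).1

/-- `J(t)`, the number of selections before time `t`, plus one. -/
def selectionNumber {𝒳 𝒴 : Type*} (err : ℕ → 𝒴 → Set 𝒴 → ℝ) (γ : ℕ → ℝ) (α q₁ : ℝ)
    (S : ℕ → 𝒳 → ℝ → Bool) (C : ℕ → 𝒳 → ℝ → Set 𝒴) (x : ℕ → 𝒳) (y : ℕ → 𝒴) (t : ℕ) : ℕ :=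
  (state err γ α q₁ S C x y t).2

theorem selectionNumber_eq {𝒳 𝒴 : Type*} (err : ℕ → 𝒴 → Set 𝒴 → ℝ) (γ : ℕ → ℝ) (α q₁ : ℝ)
    (S : ℕ → 𝒳 → ℝ → Bool) (C : ℕ → 𝒳 → ℝ → Set 𝒴) (x : ℕ → 𝒳) (y : ℕ → 𝒴) (t : ℕ) :
    selectionNumber err γ α q₁ S C x y (t + 1) =
      ∑ i ∈ Finset.Icc 1 t, (S i (x i) (threshold err γ α q₁ S C x y i)).toNat + 1 := by
  induction t with
  | zero => simp [selectionNumber, state]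
  | succ t ih =>
    rw [Finset.sum_Icc_succ_top (by omega)]
    have h : selectionNumber err γ α q₁ S C x y (t + 1 + 1) =
        selectionNumber err γ α q₁ S C x y (t + 1) +
          (S (t + 1) (x (t + 1)) (threshold err γ α q₁ S C x y (t + 1))).toNat := rfl
    rw [h, ih]
    omega

theorem threshold_succ {𝒳 𝒴 : Type*} (err : ℕ → 𝒴 → Set 𝒴 → ℝ) (γ : ℕ → ℝ) (α q₁ : ℝ)
    (S : ℕ → 𝒳 → ℝ → Bool) (C : ℕ → 𝒳 → ℝ → Set 𝒴) (x : ℕ → 𝒳) (y : ℕ → 𝒴) (t : ℕ)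
    (ht : 1 ≤ t) :
    threshold err γ α q₁ S C x y (t + 1) =
      threshold err γ α q₁ S C x y t + γ (selectionNumber err γ α q₁ S C x y t) *
        (react (err t) (y t) (C t (x t) (threshold err γ α q₁ S C x y t))
          (threshold err γ α q₁ S C x y t) - α) *
        ((S t (x t) (threshold err γ α q₁ S C x y t)).toNat : ℝ) := by
  obtain ⟨k, rfl⟩ : ∃ k, t = k + 1 := ⟨t - 1, by omega⟩
  rfl

/-- Instantaneous error rate `E[err(Y, C) | S = 1, 𝓕]`, that is
`E[err(Y, C) S | 𝓕] / P(S = 1 | 𝓕)`, with value `0` where `P(S = 1 | 𝓕) = 0`. -/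
def instErrorRate {Ω 𝒴 : Type*} [MeasurableSpace Ω] (P : Measure Ω) (𝓕 : MeasurableSpace Ω)
    (err : 𝒴 → Set 𝒴 → ℝ) (Y : Ω → 𝒴) (C : Ω → Set 𝒴) (S : Ω → Bool) (ω : Ω) : ℝ :=
  (P[fun ω' => err (Y ω') (C ω') * ((S ω').toNat : ℝ) | 𝓕]) ω /
    (P[fun ω' => ((S ω').toNat : ℝ) | 𝓕]) ω

/-! ### The Gaussian prediction interval -/

/-- `Φ⁻¹`, the quantile function of the standard normal distribution (used on `(0, 1)` only). -/
def stdNormalQuantile (p : ℝ) : ℝ :=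
  sInf {x : ℝ | p ≤ cdf (gaussianReal 0 1) x}

/-- The interval `[m ± Φ⁻¹((q + 1) / 2)]` for `q ∈ (0, 1)`, with the conventions `{m}` for `q ≤ 0`
and `ℝ` for `q ≥ 1`. -/
def gaussInterval (m q : ℝ) : Set ℝ :=
  if q ≤ 0 then {m}
  else if q < 1 then
    Set.Icc (m - stdNormalQuantile ((q + 1) / 2)) (m + stdNormalQuantile ((q + 1) / 2))
  else Set.univ

/-! ### The autoregressive model -/

/-- `(Y_t)_{t ∈ ℤ}` is a centered (strictly) stationary AR(d) process with coefficients
`φ = (φ_1, …, φ_d)` (the coordinate `φ k`, `k : Fin d`, is `φ_{k+1}`) and i.i.d. standard Gaussian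
innovations `Z`, and the polynomial `1 - ∑_k φ_k z^k` has no complex root in the closed unit disc. -/
structure IsStationaryAR {Ω : Type*} [MeasurableSpace Ω] (P : Measure Ω) {d : ℕ}
    (φ : EuclideanSpace ℝ (Fin d)) (Y Z : ℤ → Ω → ℝ) : Prop where
  measurable : ∀ t, Measurable (Y t)
  innovations_indep : iIndepFun Z P
  innovations_law : ∀ t, HasLaw (Z t) (gaussianReal 0 1) P
  recursion : ∀ t, ∀ᵐ ω ∂P, Y t ω = ∑ k : Fin d, φ k * Y (t - ((k : ℕ) + 1)) ω + Z t ω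
  stationary : ∀ h : ℤ, P.map (fun ω t => Y (t + h) ω) = P.map (fun ω t => Y t ω)
  integrable : ∀ t, Integrable (Y t) P
  centered : ∀ t, ∫ ω, Y t ω ∂P = 0
  no_root : ∀ z : ℂ, ‖z‖ ≤ 1 → 1 - ∑ k : Fin d, (φ k : ℂ) * z ^ ((k : ℕ) + 1) ≠ 0

/-- The covariate `X_t = (Y_{t-1}, …, Y_{t-d})`. -/
def arCovariate {Ω : Type*} (d : ℕ) (Y : ℤ → Ω → ℝ) (t : ℕ) (ω : Ω) : EuclideanSpace ℝ (Fin d) :=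
  WithLp.toLp 2 (fun k : Fin d => Y ((t : ℤ) - ((k : ℕ) + 1)) ω)

/-- `𝓕_t = σ(Y_{-(n-1)}, …, Y_t)`. -/
@[reducible] def arFiltration {Ω : Type*} (Y : ℤ → Ω → ℝ) (n : ℕ) (t : ℤ) : MeasurableSpace Ω :=
  ⨆ s ∈ Set.Icc (-((n : ℤ) - 1)) t, MeasurableSpace.comap (Y s) inferInstance

/-- In-probability estimation rate: for some `C₁ > 0` and all large `t`,
`P( E[|μ̂_t(X_t) - μ(X_t)| | 𝓕_{t-1}] ≥ C₁ (log t)^{ν₀} t^{-ν} ) ≤ 3 / (π² t³)`,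
where `μ(x) = ⟨φ, x⟩` and `μ̂_t(x) = ⟨φ̂_t, x⟩`. The conditional expectation of this nonnegative
variable is the one with values in `[0, ∞]`. -/
def EstimRateInProb {Ω : Type*} [MeasurableSpace Ω] (P : Measure Ω) {d : ℕ}
    (φ : EuclideanSpace ℝ (Fin d)) (Y : ℤ → Ω → ℝ) (n : ℕ)
    (φhat : ℕ → Ω → EuclideanSpace ℝ (Fin d)) (ν₀ ν : ℝ) : Prop :=
  ∃ C₁ : ℝ, 0 < C₁ ∧ ∀ᶠ t : ℕ in atTop,
    P {ω | ENNReal.ofReal (C₁ * Real.log t ^ ν₀ * (t : ℝ) ^ (-ν)) ≤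
        (P⁻[fun ω' => ENNReal.ofReal
            |inner ℝ (φhat t ω') (arCovariate d Y t ω') - inner ℝ φ (arCovariate d Y t ω')|
          | arFiltration Y n ((t : ℤ) - 1)]) ω}
      ≤ ENNReal.ofReal (3 / (Real.pi ^ 2 * (t : ℝ) ^ 3))

/-- Mean-square estimation rate: for some `C₁ > 0` and all large `t`,
`E[(μ̂_t(X_t) - μ(X_t))²] ≤ C₁ (log t)^{2 τ₀} t^{-2 τ}`. -/
def EstimRateInMean {Ω : Type*} [MeasurableSpace Ω] (P : Measure Ω) {d : ℕ}
    (φ : EuclideanSpace ℝ (Fin d)) (Y : ℤ → Ω → ℝ)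
    (φhat : ℕ → Ω → EuclideanSpace ℝ (Fin d)) (τ₀ τ : ℝ) : Prop :=
  ∃ C₁ : ℝ, 0 < C₁ ∧ ∀ᶠ t : ℕ in atTop,
    ∫⁻ ω, ENNReal.ofReal
        ((inner ℝ (φhat t ω) (arCovariate d Y t ω) - inner ℝ φ (arCovariate d Y t ω)) ^ 2) ∂P
      ≤ ENNReal.ofReal (C₁ * Real.log t ^ (2 * τ₀) * (t : ℝ) ^ (-(2 * τ)))

/-! ### The procedure in the autoregressive model, without selection -/

/-- The selection rule that always selects. -/
def noSelection {𝒳 : Type*} (_t : ℕ) (_x : 𝒳) (_q : ℝ) : Bool := true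

/-- The prediction set rule `C_t(x, q) = [⟨φ̂_t, x⟩ ± Φ⁻¹((q + 1) / 2)]` at the outcome `ω`. -/
def arInterval {Ω : Type*} {d : ℕ} (φhat : ℕ → Ω → EuclideanSpace ℝ (Fin d)) (ω : Ω) (t : ℕ)
    (x : EuclideanSpace ℝ (Fin d)) (q : ℝ) : Set ℝ :=
  gaussInterval (inner ℝ (φhat t ω) x) q

/-- The random threshold `q_t`, with steps `γ_j = c j^{-β}`. -/
def arThreshold {Ω : Type*} {d : ℕ} (Y : ℤ → Ω → ℝ) (φhat : ℕ → Ω → EuclideanSpace ℝ (Fin d))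
    (α c β q₁ : ℝ) (t : ℕ) (ω : Ω) : ℝ :=
  threshold (fun _ => coverageErr) (fun j : ℕ => c * (j : ℝ) ^ (-β)) α q₁ noSelection
    (arInterval φhat ω) (fun k => arCovariate d Y k ω) (fun k => Y (k : ℤ) ω) t

/-- `IER_t`, the instantaneous error rate of the procedure at time `t`, given `𝓕_{t-1}`. -/
def arIER {Ω : Type*} [MeasurableSpace Ω] (P : Measure Ω) {d : ℕ} (Y : ℤ → Ω → ℝ) (n : ℕ)
    (φhat : ℕ → Ω → EuclideanSpace ℝ (Fin d)) (α c β q₁ : ℝ) (t : ℕ) (ω : Ω) : ℝ :=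
  instErrorRate P (arFiltration Y n ((t : ℤ) - 1)) coverageErr (Y (t : ℤ))
    (fun ω' => arInterval φhat ω' t (arCovariate d Y t ω') (arThreshold Y φhat α c β q₁ t ω'))
    (fun ω' => noSelection t (arCovariate d Y t ω') (arThreshold Y φhat α c β q₁ t ω')) ω

/-- The rate `ρ(t)`, for a lower limit `β₀` of the first regime. -/
def rate (β₀ β : ℝ) (t : ℕ) : ℝ :=
  if β₀ < β ∧ β < 3 / 4 then Real.log t ^ (1 / 2 : ℝ) * (t : ℝ) ^ (-(β / 3))
  else Real.log t ^ (1 / 2 : ℝ) * (t : ℝ) ^ (1 / 2 - β) + (t : ℝ) ^ (β - 1)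

end OnlineSCI

end

/-! Write `e_t = q_t - (1 - α)`. The interval misses `Y_t` exactly when the probability integral
transform of `|Y_t - ⟨φ̂_t, X_t⟩|` exceeds `max q_t 0`. The residual is `Z_t - δ_t`, where the
prediction error `δ_t = ⟨φ̂_t - φ, X_t⟩` is known at time `t - 1`, as is `q_t`. If `Z_t` is
independent of `𝓕_{t-1}`, then `IER_t` is an explicit function of `(δ_t, q_t)`. It differs from `1 -
q_t`, with `q_t` clamped to `[0, 1]`, by a bias `b_t ≤ |δ_t|`, because the normal density is at most
`1/2` and each of the two endpoints is displaced by `δ_t`.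

This independence is not part of the model and comes from causality. The equation reads `Q(B) Y = Z`
with `B` the backward shift and `Q` free of roots in the closed disc. Factoring `Q` over `ℂ` and
inverting one factor `B - z`, `|z| > 1`, at a time by a convergent geometric iteration shows that
`Y_t` is a function of the innovations up to `t`, up to null sets
(`aestronglyMeasurable_of_aeval_backshift`, `IsStationaryAR.indep_arFiltration`).

The threshold then obeys a Robbins–Monro recursion with bounded centered noise. It stays in `[-c, 1
+ c]`, where the mean drift contracts at rate `κ γ_t` with `κ = min α (1 - α) / (1 + c)`
(`abs_add_drift_le`, `isContractingScheme`). Since `β < 1`, products of `1 - a t^{-β}` decay faster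
than any power `t^{-p}` with `p ≤ 1` (`eventually_rpow_mul_le`), so power-law bounds propagate by
induction.

For second moments this gives `E e_t² = O(t^{-β})` (`exists_integral_sq_le`), hence part (2). For
part (1), the moments of `cosh (l e_t)` are propagated on the event that the bias has been small
since a time of order `√t`, and a Chernoff bound gives `|e_t| = O((log t)^{1/2} t^{-β/2} + (log
t)^{3/2} t^{-1/2})` outside an event of probability `1/t`. The first term is dominated by `ρ(t)`. -/

noncomputable section

namespace OnlineSCI

/-! ### The standard normal distribution function and the prediction interval -/

/-- The standard normal distribution function. -/
abbrev stdNormalCdf (x : ℝ) : ℝ := cdf (gaussianReal 0 1) x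

theorem stdNormalCdf_sub {x y : ℝ} (h : x ≤ y) :
    stdNormalCdf y - stdNormalCdf x = (gaussianReal 0 1).real (Set.Ioc x y) := by
  rw [stdNormalCdf, stdNormalCdf, cdf_eq_real, cdf_eq_real, ← Set.Iic_sdiff_Iic,
    measureReal_sdiff (Set.Iic_subset_Iic.2 h) measurableSet_Iic]

/-- The density is at most `1 / √(2π)`. The value `1/2` makes the errors at the two endpoints of an
interval add up to `|δ|`. -/
theorem gaussianPDFReal_le_half (x : ℝ) : gaussianPDFReal 0 1 x ≤ 1 / 2 := by
  have h2 : (2 : ℝ) ≤ √(2 * Real.pi * ((1 : NNReal) : ℝ)) := by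
    apply Real.le_sqrt_of_sq_le
    have := Real.pi_gt_three
    simp only [NNReal.coe_one]
    linarith
  have h3 : Real.exp (-(x - 0) ^ 2 / (2 * ((1 : NNReal) : ℝ))) ≤ 1 := by
    apply Real.exp_le_one_iff.2
    have := sq_nonneg (x - 0)
    simp only [NNReal.coe_one]
    linarith
  have h4 : (√(2 * Real.pi * ((1 : NNReal) : ℝ)))⁻¹ ≤ 1 / 2 := by
    rw [one_div]
    exact inv_anti₀ two_pos h2
  rw [gaussianPDFReal]
  calc _ ≤ (1 / 2 : ℝ) * 1 := mul_le_mul h4 h3 (Real.exp_nonneg _) (by norm_num)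
    _ = _ := mul_one _

theorem gaussianReal_Ioc_le {x y : ℝ} (h : x ≤ y) :
    (gaussianReal 0 1).real (Set.Ioc x y) ≤ (y - x) / 2 := by
  have h1 : gaussianReal 0 1 (Set.Ioc x y) ≤ ENNReal.ofReal ((y - x) / 2) := by
    rw [gaussianReal_apply _ one_ne_zero]
    calc ∫⁻ z in Set.Ioc x y, gaussianPDF 0 1 z
        ≤ ∫⁻ _ in Set.Ioc x y, ENNReal.ofReal (1 / 2) :=
          lintegral_mono fun z => ENNReal.ofReal_le_ofReal (gaussianPDFReal_le_half z)
      _ = ENNReal.ofReal ((y - x) / 2) := by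
          rw [setLIntegral_const, Real.volume_Ioc, ← ENNReal.ofReal_mul (by norm_num)]
          congr 1
          ring
  exact ENNReal.toReal_le_of_le_ofReal (by linarith) h1

theorem abs_stdNormalCdf_sub_le (x y : ℝ) :
    |stdNormalCdf y - stdNormalCdf x| ≤ |y - x| / 2 := by
  rcases le_total x y with h | h
  · rw [abs_of_nonneg (sub_nonneg.2 h), stdNormalCdf_sub h, abs_of_nonneg measureReal_nonneg]
    exact gaussianReal_Ioc_le h
  · rw [abs_sub_comm, abs_sub_comm y, abs_of_nonneg (sub_nonneg.2 h), stdNormalCdf_sub h,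
      abs_of_nonneg measureReal_nonneg]
    exact gaussianReal_Ioc_le h

theorem continuous_stdNormalCdf : Continuous stdNormalCdf := by
  have : LipschitzWith 1 stdNormalCdf := LipschitzWith.of_dist_le_mul fun x y => by
    rw [Real.dist_eq, Real.dist_eq, NNReal.coe_one, one_mul]
    have := abs_stdNormalCdf_sub_le y x
    have := abs_nonneg (x - y)
    linarith
  exact this.continuous

theorem strictMono_stdNormalCdf : StrictMono stdNormalCdf := by
  intro x y h
  rw [← sub_pos, stdNormalCdf_sub h.le]
  apply ENNReal.toReal_pos _ (measure_ne_top _ _)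
  intro h0
  have := gaussianReal_absolutelyContinuous' 0 (one_ne_zero (α := NNReal)) h0
  rw [Real.volume_Ioc, ENNReal.ofReal_eq_zero] at this
  linarith

theorem stdNormalCdf_neg (x : ℝ) : stdNormalCdf (-x) = 1 - stdNormalCdf x := by
  have : NullSingletonClass (gaussianReal 0 1) := nullSingletonClass_gaussianReal one_ne_zero
  have h1 : gaussianReal 0 1 (Set.Iic (-x)) = gaussianReal 0 1 (Set.Ici x) := by
    conv_lhs => rw [← neg_zero, ← gaussianReal_map_neg]
    rw [Measure.map_apply measurable_neg measurableSet_Iic]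
    congr 1
    ext z
    simp
  rw [stdNormalCdf, cdf_eq_real, stdNormalCdf, cdf_eq_real, measureReal_def, h1,
    ← measureReal_def, ← Set.compl_Iio, probReal_compl_eq_one_sub measurableSet_Iio]
  congr 1
  exact measureReal_congr Iio_ae_eq_Iic

theorem stdNormalCdf_zero : stdNormalCdf 0 = 1 / 2 := by
  have := stdNormalCdf_neg 0
  rw [neg_zero] at this
  linarith

theorem stdNormalCdf_lt_one (x : ℝ) : stdNormalCdf x < 1 :=
  (strictMono_stdNormalCdf (lt_add_one x)).trans_le (cdf_le_one _ _)

theorem exists_stdNormalCdf_eq {p : ℝ} (hp : p ∈ Set.Ioo (0 : ℝ) 1) : ∃ x, stdNormalCdf x = p := by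
  apply mem_range_of_exists_le_of_exists_ge continuous_stdNormalCdf
  · obtain ⟨x, hx⟩ := ((tendsto_cdf_atBot (gaussianReal 0 1)).eventually_lt_const hp.1).exists
    exact ⟨x, hx.le⟩
  · obtain ⟨x, hx⟩ := ((tendsto_cdf_atTop (gaussianReal 0 1)).eventually_const_lt hp.2).exists
    exact ⟨x, hx.le⟩

theorem stdNormalCdf_stdNormalQuantile {p : ℝ} (hp : p ∈ Set.Ioo (0 : ℝ) 1) :
    stdNormalCdf (stdNormalQuantile p) = p := by
  obtain ⟨x, hx⟩ := exists_stdNormalCdf_eq hp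
  have : {y : ℝ | p ≤ cdf (gaussianReal 0 1) y} = Set.Ici x := by
    ext y
    rw [Set.mem_ofPred_eq, Set.mem_Ici, ← hx]
    exact strictMono_stdNormalCdf.le_iff_le
  rw [stdNormalQuantile, this, csInf_Ici, hx]

/-- The probability integral transform of the absolute residual `|z|`. -/
def residualRank (z : ℝ) : ℝ := 2 * stdNormalCdf |z| - 1

theorem continuous_residualRank : Continuous residualRank := by
  have := continuous_stdNormalCdf
  unfold residualRank
  fun_prop

theorem residualRank_le_iff {z p : ℝ} (hp : p ∈ Set.Ioo (0 : ℝ) 1) :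
    residualRank z ≤ p ↔ |z| ≤ stdNormalQuantile ((p + 1) / 2) := by
  have h := stdNormalCdf_stdNormalQuantile (p := (p + 1) / 2)
    ⟨by linarith [hp.1], by linarith [hp.2]⟩
  rw [← strictMono_stdNormalCdf.le_iff_le (a := |z|), h, residualRank]
  constructor <;> intro h <;> linarith

/-- One inequality covers the three conventions: the rank is nonnegative and vanishes only at `0`,
which gives the singleton for `q ≤ 0`, and it is always below `1`, which gives the whole line for `q
≥ 1`. -/
theorem mem_gaussInterval_iff {m q y : ℝ} :
    y ∈ gaussInterval m q ↔ residualRank (y - m) ≤ max q 0 := by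
  unfold gaussInterval
  split_ifs with h0 h1
  · rw [max_eq_right h0, Set.mem_singleton_iff, residualRank, ← sub_eq_zero (a := y),
      ← abs_eq_zero, ← abs_nonpos_iff, abs_abs, ← strictMono_stdNormalCdf.le_iff_le,
      stdNormalCdf_zero]
    constructor <;> intro h <;> linarith
  · rw [max_eq_left (by linarith), residualRank_le_iff ⟨by linarith, h1⟩, abs_le, Set.mem_Icc]
    constructor <;> rintro ⟨h2, h3⟩ <;> constructor <;> linarith
  · have := stdNormalCdf_lt_one |y - m|
    simp only [Set.mem_univ, true_iff]
    rw [le_max_iff, residualRank]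
    left
    linarith

/-- The probability that the interval `gaussInterval δ q` misses a standard normal variable. -/
def missProb (δ q : ℝ) : ℝ :=
  (gaussianReal 0 1).real {z | max q 0 < residualRank (z - δ)}

/-- The covering probability targeted by the threshold `q`. -/
def clampUnit (q : ℝ) : ℝ := max 0 (min q 1)

theorem gaussianReal_Icc (a b : ℝ) (h : a ≤ b) :
    (gaussianReal 0 1).real (Set.Icc a b) = stdNormalCdf b - stdNormalCdf a := by
  have : NullSingletonClass (gaussianReal 0 1) := nullSingletonClass_gaussianReal one_ne_zero
  rw [stdNormalCdf_sub h]
  exact measureReal_congr Ioc_ae_eq_Icc.symm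

/-- For `δ = 0` and `0 < q < 1` the interval has normal mass exactly `q`. Translating it by `δ`
changes the distribution function at each endpoint by at most `|δ| / 2`. Outside `(0, 1)` there is
no error at all. -/
theorem abs_missProb_sub_le (δ q : ℝ) : |missProb δ q - (1 - clampUnit q)| ≤ |δ| := by
  have : NullSingletonClass (gaussianReal 0 1) := nullSingletonClass_gaussianReal one_ne_zero
  have hset : {z | max q 0 < residualRank (z - δ)} = (gaussInterval δ q)ᶜ := by
    ext z
    rw [Set.mem_compl_iff, mem_gaussInterval_iff, not_le, Set.mem_ofPred_eq]
  rw [missProb, hset]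
  unfold gaussInterval clampUnit
  split_ifs with h0 h1
  · rw [probReal_compl_eq_one_sub (measurableSet_singleton _), min_eq_left (by linarith),
      max_eq_left h0, measureReal_def, measure_singleton]
    simp
  · rw [probReal_compl_eq_one_sub measurableSet_Icc, min_eq_left h1.le,
      max_eq_right (by linarith)]
    have hQ := stdNormalCdf_stdNormalQuantile (p := (q + 1) / 2) ⟨by linarith, by linarith⟩
    set a := stdNormalQuantile ((q + 1) / 2)
    have ha : 0 ≤ a := by
      rw [← strictMono_stdNormalCdf.le_iff_le, stdNormalCdf_zero, hQ]
      linarith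
    rw [gaussianReal_Icc _ _ (by linarith)]
    have hn := stdNormalCdf_neg a
    have h1 := abs_le.1 (abs_stdNormalCdf_sub_le a (δ + a))
    have h2 := abs_le.1 (abs_stdNormalCdf_sub_le (-a) (δ - a))
    rw [show δ + a - a = δ by ring] at h1
    rw [show δ - a - -a = δ by ring] at h2
    rw [abs_le]
    constructor <;> linarith [h1.1, h1.2, h2.1, h2.2]
  · rw [Set.compl_univ, min_eq_right (by linarith)]
    simp

/-! ### Conditional expectations given an independent σ-algebra -/

/-- Freezing lemma: if `W` is `m`-measurable and `V` is independent of `m`, the conditional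
expectation of `ψ (W, V)` given `m` integrates out `V`. -/
theorem condExp_eq_integral_of_indep {Ω β : Type*} [MeasurableSpace β] {m m0 : MeasurableSpace Ω}
    {P : Measure Ω} [IsProbabilityMeasure P] (hm : m ≤ m0) {V : Ω → ℝ} (hV : Measurable V)
    (hind : Indep m (MeasurableSpace.comap V inferInstance) P) {W : Ω → β} (hW : Measurable[m] W)
    {ψ : β × ℝ → ℝ} (hψ : Measurable ψ) {K : ℝ} (hK : ∀ x, |ψ x| ≤ K) :
    P[fun ω => ψ (W ω, V ω) | m] =ᵐ[P] fun ω => ∫ v, ψ (W ω, v) ∂(P.map V) := by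
  have hW0 : Measurable W := hW.mono hm le_rfl
  have : IsProbabilityMeasure (P.map V) := Measure.isProbabilityMeasure_map hV.aemeasurable
  have hJ : StronglyMeasurable fun w => ∫ v, ψ (w, v) ∂(P.map V) :=
    hψ.stronglyMeasurable.integral_prod_right'
  have hJm : StronglyMeasurable[m] fun ω => ∫ v, ψ (W ω, v) ∂(P.map V) :=
    hJ.comp_measurable hW
  have hJb : ∀ w, ‖∫ v, ψ (w, v) ∂(P.map V)‖ ≤ K := fun w => by
    simpa using norm_integral_le_of_norm_le_const (μ := P.map V) (f := fun v => ψ (w, v)) (C := K)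
      (ae_of_all _ fun v => hK (w, v))
  have hint : Integrable (fun ω => ψ (W ω, V ω)) P :=
    .of_bound (hψ.comp (hW0.prodMk hV)).aestronglyMeasurable K (ae_of_all _ fun ω => hK _)
  symm
  refine ae_eq_condExp_of_forall_setIntegral_eq hm hint (fun s _ _ => ?_) (fun s hs _ => ?_)
    hJm.aestronglyMeasurable
  · exact (Integrable.of_bound (hJm.mono hm).aestronglyMeasurable K
      (ae_of_all _ fun ω => hJb _)).integrableOn
  -- The indicator of `s` is adjoined to `W`, so that integrals over `s` become integrals against
  -- the product law of `(W', V)`. Its clamping to `[0, 1]` in `χ` changes no value and keeps `χ`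
  -- bounded.
  · set W' : Ω → ℝ × β := fun ω => (s.indicator (fun _ => (1 : ℝ)) ω, W ω) with hW'
    have hW'm : Measurable[m] W' := (measurable_const.indicator hs).prodMk hW
    have hW'0 : Measurable W' := hW'm.mono hm le_rfl
    have hind' : IndepFun W' V P := indep_of_indep_of_le_left hind hW'm.comap_le
    have hmap := (indepFun_iff_map_prod_eq_prod_map_map hW'0.aemeasurable hV.aemeasurable).1 hind'
    have : IsProbabilityMeasure (P.map W') := Measure.isProbabilityMeasure_map hW'0.aemeasurable
    set χ : (ℝ × β) × ℝ → ℝ := fun x => max 0 (min x.1.1 1) * ψ (x.1.2, x.2) with hχ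
    have hχm : Measurable χ := by fun_prop
    have hχb : ∀ x, ‖χ x‖ ≤ K := fun x => by
      have h1 : |max 0 (min x.1.1 1)| ≤ 1 := by
        rw [abs_of_nonneg (le_max_left _ _)]
        exact max_le zero_le_one (min_le_right _ _)
      rw [hχ, Real.norm_eq_abs, abs_mul]
      calc _ ≤ 1 * K := mul_le_mul h1 (hK _) (abs_nonneg _) zero_le_one
        _ = K := one_mul K
    have hval : ∀ ω v, χ (W' ω, v) = s.indicator (fun ω => ψ (W ω, v)) ω := fun ω v => by
      by_cases h : ω ∈ s <;> simp [hχ, hW', h]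
    have hχi : Integrable χ ((P.map W').prod (P.map V)) :=
      .of_bound hχm.aestronglyMeasurable K (ae_of_all _ hχb)
    calc ∫ ω in s, ∫ v, ψ (W ω, v) ∂(P.map V) ∂P
        = ∫ ω, ∫ v, χ (W' ω, v) ∂(P.map V) ∂P := by
          rw [← integral_indicator (hm _ hs)]
          refine integral_congr_ae (ae_of_all _ fun ω => ?_)
          simp only [hval]
          by_cases h : ω ∈ s <;> simp [h]
      _ = ∫ w, ∫ v, χ (w, v) ∂(P.map V) ∂(P.map W') := by
          rw [integral_map hW'0.aemeasurable]
          exact hχm.stronglyMeasurable.integral_prod_right'.aestronglyMeasurable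
      _ = ∫ x, χ x ∂(P.map fun ω => (W' ω, V ω)) := by
          rw [hmap, integral_prod _ hχi]
      _ = ∫ ω in s, ψ (W ω, V ω) ∂P := by
          rw [integral_map (hW'0.prodMk hV).aemeasurable hχm.aestronglyMeasurable,
            ← integral_indicator (hm _ hs)]
          refine integral_congr_ae (ae_of_all _ fun ω => ?_)
          simp only [hval]
          by_cases h : ω ∈ s <;> simp [h]

/-! ### Causality of stationary autoregressive processes -/

/-- The backward shift on complex processes indexed by `ℤ`. -/
def backshift (Ω : Type*) : (ℤ → Ω → ℂ) →ₗ[ℂ] (ℤ → Ω → ℂ) where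
  toFun V t := V (t - 1)
  map_add' _ _ := rfl
  map_smul' _ _ := rfl

/-- A process that is almost everywhere measurable and bounded in `L¹`. -/
structure BoundedL1 {Ω : Type*} [MeasurableSpace Ω] (P : Measure Ω) (V : ℤ → Ω → ℂ) : Prop where
  aemeasurable : ∀ t, AEMeasurable (V t) P
  bound : ∃ K : ℝ≥0∞, K ≠ ∞ ∧ ∀ t, ∫⁻ ω, ‖V t ω‖ₑ ∂P ≤ K

theorem BoundedL1.backshift_sub {Ω : Type*} [MeasurableSpace Ω] {P : Measure Ω}
    {V : ℤ → Ω → ℂ} (hV : BoundedL1 P V) (z : ℂ) :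
    BoundedL1 P (backshift Ω V - z • V) := by
  obtain ⟨K, hK, hb⟩ := hV.bound
  refine ⟨fun t => (hV.aemeasurable (t - 1)).sub ((hV.aemeasurable t).const_smul z),
    K + ‖z‖ₑ * K, by finiteness, fun t => ?_⟩
  calc ∫⁻ ω, ‖V (t - 1) ω - z * V t ω‖ₑ ∂P
      ≤ ∫⁻ ω, (‖V (t - 1) ω‖ₑ + ‖z‖ₑ * ‖V t ω‖ₑ) ∂P :=
        lintegral_mono fun ω => (enorm_sub_le).trans_eq (by rw [enorm_mul])
    _ = ∫⁻ ω, ‖V (t - 1) ω‖ₑ ∂P + ‖z‖ₑ * ∫⁻ ω, ‖V t ω‖ₑ ∂P := by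
        rw [lintegral_add_left' (hV.aemeasurable _).enorm,
          lintegral_const_mul'' _ (hV.aemeasurable _).enorm]
    _ ≤ K + ‖z‖ₑ * K := by gcongr <;> exact hb _

/-- The `L¹` norms are dominated by a geometric series, so the sum over `m` is almost surely finite
and its terms tend to zero. -/
theorem BoundedL1.tendsto_pow_mul {Ω : Type*} [MeasurableSpace Ω] {P : Measure Ω}
    {V : ℤ → Ω → ℂ} (hV : BoundedL1 P V) {r : ℂ} (hr : ‖r‖ < 1) (t : ℤ) :
    ∀ᵐ ω ∂P, Tendsto (fun m : ℕ => r ^ m * V (t - m) ω) atTop (𝓝 0) := by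
  obtain ⟨K, hK, hb⟩ := hV.bound
  have hm : ∀ m : ℕ, AEMeasurable (fun ω => ‖r ^ m * V (t - m) ω‖ₑ) P := fun m =>
    ((hV.aemeasurable _).const_mul _).enorm
  have h1 : ∫⁻ ω, ∑' m : ℕ, ‖r ^ m * V (t - m) ω‖ₑ ∂P ≠ ∞ := by
    rw [lintegral_tsum hm]
    have h2 : ∀ m : ℕ, ∫⁻ ω, ‖r ^ m * V (t - m) ω‖ₑ ∂P ≤ ‖r‖ₑ ^ m * K := fun m => by
      simp_rw [enorm_mul, enorm_pow]
      rw [lintegral_const_mul'' _ (hV.aemeasurable _).enorm]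
      gcongr
      exact hb _
    refine ne_top_of_le_ne_top ?_ (ENNReal.tsum_le_tsum h2)
    rw [ENNReal.tsum_mul_right, ENNReal.tsum_geometric]
    refine ENNReal.mul_ne_top (ENNReal.inv_ne_top.2 ?_) hK
    have : ‖r‖ₑ < 1 := by
      rw [← ofReal_norm, ← ENNReal.ofReal_one]
      exact (ENNReal.ofReal_lt_ofReal_iff one_pos).2 hr
    exact (tsub_pos_of_lt this).ne'
  filter_upwards [ae_lt_top' (AEMeasurable.tsum hm) h1] with ω hω
  exact tendsto_zero_iff_enorm_tendsto_zero.2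
    (ENNReal.tendsto_atTop_zero_of_tsum_ne_top hω.ne)

/-- If `(B - z) V` is adapted, where `B` is the backward shift and `‖z‖ > 1`, then so is `V`. -/
theorem aestronglyMeasurable_of_backshift_sub {Ω : Type*} {m0 : MeasurableSpace Ω} {P : Measure Ω}
    {G : ℤ → MeasurableSpace Ω} (hG : Monotone G) {V : ℤ → Ω → ℂ} (hV : BoundedL1 P V) {z : ℂ}
    (hz : 1 < ‖z‖) (hU : ∀ t, AEStronglyMeasurable[G t] ((backshift Ω V - z • V) t) P) (t : ℤ) :
    AEStronglyMeasurable[G t] (V t) P := by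
  have hz0 : z ≠ 0 := norm_pos_iff.1 (one_pos.trans hz)
  -- With `U = (B - z) V`, iterating `V_t = z⁻¹ (V_{t-1} - U_t)` leaves `V_t - z⁻ᵐ V_{t-m} =
  -- -∑_{j<m} z^{-(j+1)} U_{t-j}`, which involves `U` up to time `t` only.
  have hW : ∀ m : ℕ, AEStronglyMeasurable[G t] (fun ω => V t ω - z⁻¹ ^ m * V (t - m) ω) P := by
    intro m
    induction m with
    | zero => 
      simpa using (aestronglyMeasurable_const : AEStronglyMeasurable[G t] (fun _ : Ω => (0 : ℂ)) P)
    | succ m ih =>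
      have h1 : AEStronglyMeasurable[G t] ((backshift Ω V - z • V) (t - m)) P :=
        (hU (t - m)).mono (hG (by omega))
      refine (ih.sub (h1.const_mul (z⁻¹ ^ (m + 1)))).congr (ae_of_all _ fun ω => ?_)
      change V t ω - z⁻¹ ^ m * V (t - m) ω - z⁻¹ ^ (m + 1) * (V (t - m - 1) ω - z * V (t - m) ω) =
        V t ω - z⁻¹ ^ (m + 1) * V (t - ((m + 1 : ℕ) : ℤ)) ω
      rw [show t - ((m + 1 : ℕ) : ℤ) = t - m - 1 by push_cast; ring, pow_succ]
      field_simp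
      ring
  -- The σ-algebras are not complete, so the witness is the pointwise limit of `G t`-measurable
  -- versions. It agrees with `V t` almost surely because the remainder vanishes.
  refine ⟨fun ω => limUnder atTop fun m => (hW m).mk _ ω,
    @StronglyMeasurable.limUnder _ _ _ (G t) _ _ _ _ _ _ _
      fun m => (hW m).stronglyMeasurable_mk, ?_⟩
  have hr : ‖z⁻¹‖ < 1 := by
    rw [norm_inv]
    exact inv_lt_one_of_one_lt₀ hz
  filter_upwards [hV.tendsto_pow_mul hr t, ae_all_iff.2 fun m => (hW m).ae_eq_mk] with ω hω h2
  refine (Tendsto.limUnder_eq ?_).symm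
  simp only [← h2]
  simpa using tendsto_const_nhds.sub hω

/-- The factors commute, so the one with root `a` may act first. The induction hypothesis, applied
to `(B - a) V`, makes that process adapted, and the single-factor case recovers `V`. -/
theorem aestronglyMeasurable_of_prod_backshift {Ω : Type*} {m0 : MeasurableSpace Ω}
    {P : Measure Ω} {G : ℤ → MeasurableSpace Ω} (hG : Monotone G) (s : Multiset ℂ)
    (hs : ∀ z ∈ s, 1 < ‖z‖) {V : ℤ → Ω → ℂ} (hV : BoundedL1 P V)
    (hU : ∀ t, AEStronglyMeasurable[G t]
      (Polynomial.aeval (backshift Ω) (s.map fun z => Polynomial.X - Polynomial.C z).prod V t) P)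
    (t : ℤ) : AEStronglyMeasurable[G t] (V t) P := by
  induction s using Multiset.induction_on generalizing V t with
  | empty => simpa using hU t
  | cons a s ih =>
    have h1 : ∀ t, AEStronglyMeasurable[G t] ((backshift Ω V - a • V) t) P := by
      refine ih (fun z hz => hs z (Multiset.mem_cons_of_mem hz)) (hV.backshift_sub a) fun t => ?_
      have h2 := hU t
      rw [Multiset.map_cons, Multiset.prod_cons, mul_comm, map_mul, Module.End.mul_apply] at h2
      simpa [Algebra.algebraMap_eq_smul_one] using h2
    exact aestronglyMeasurable_of_backshift_sub hG hV (hs a (Multiset.mem_cons_self a s)) h1 t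

/-- A process bounded in `L¹` is adapted as soon as some polynomial in the backward shift without
roots in the closed unit disc maps it to an adapted process. -/
theorem aestronglyMeasurable_of_aeval_backshift {Ω : Type*} {m0 : MeasurableSpace Ω}
    {P : Measure Ω} {G : ℤ → MeasurableSpace Ω} (hG : Monotone G) {Q : Polynomial ℂ}
    (hQ : ∀ z : ℂ, ‖z‖ ≤ 1 → Q.eval z ≠ 0) {V : ℤ → Ω → ℂ} (hV : BoundedL1 P V)
    (hU : ∀ t, AEStronglyMeasurable[G t] (Polynomial.aeval (backshift Ω) Q V t) P) (t : ℤ) :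
    AEStronglyMeasurable[G t] (V t) P := by
  have hQ0 : Q ≠ 0 := by
    rintro rfl
    exact hQ 0 (by simp) (by simp)
  have hlc : Q.leadingCoeff ≠ 0 := Polynomial.leadingCoeff_ne_zero.2 hQ0
  refine aestronglyMeasurable_of_prod_backshift hG Q.roots (fun z hz => ?_) hV (fun t => ?_) t
  · by_contra h
    exact hQ z (not_lt.1 h) ((Polynomial.mem_roots hQ0).1 hz)
  · have h1 : Polynomial.aeval (backshift Ω) Q V t = Q.leadingCoeff • Polynomial.aeval
        (backshift Ω) (Q.roots.map fun z => Polynomial.X - Polynomial.C z).prod V t := by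
      conv_lhs => rw [(IsAlgClosed.splits Q).eq_prod_roots]
      simp only [map_mul, Polynomial.aeval_C, Module.End.mul_apply, Module.algebraMap_end_apply,
        Pi.smul_apply]
    have h2 := (hU t).const_smul Q.leadingCoeff⁻¹
    rwa [h1, inv_smul_smul₀ hlc] at h2

/-! ### Innovations and their independence of the observed past -/

namespace IsStationaryAR

variable {Ω : Type*} {m0 : MeasurableSpace Ω} {P : Measure Ω} {d : ℕ}
  {φ : EuclideanSpace ℝ (Fin d)} {Y Z : ℤ → Ω → ℝ}

/-- The innovation `Y_t - ∑ φ_k Y_{t-k}`, as a function of the observed process. -/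
def innovation {d : ℕ} (φ : EuclideanSpace ℝ (Fin d)) (Y : ℤ → Ω → ℝ) (t : ℤ) (ω : Ω) : ℝ :=
  Y t ω - ∑ k : Fin d, φ k * Y (t - ((k : ℕ) + 1)) ω

/-- This replaces `Z` by a version that is an exact function of the path of `Y`, so that later
pathwise identities hold everywhere. -/
theorem ae_eq_innovation (h : IsStationaryAR P φ Y Z) (t : ℤ) : Z t =ᵐ[P] innovation φ Y t := by
  filter_upwards [h.recursion t] with ω hω
  rw [innovation, hω]
  ring

theorem measurable_innovation (h : IsStationaryAR P φ Y Z) (t : ℤ) :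
    Measurable (innovation φ Y t) := by
  have := h.measurable
  unfold innovation
  fun_prop

theorem map_innovation (h : IsStationaryAR P φ Y Z) (t : ℤ) :
    P.map (innovation φ Y t) = gaussianReal 0 1 := by
  rw [← Measure.map_congr (h.ae_eq_innovation t)]
  exact (h.innovations_law t).map_eq

theorem lintegral_enorm (h : IsStationaryAR P φ Y Z) (t : ℤ) :
    ∫⁻ ω, ‖Y t ω‖ₑ ∂P = ∫⁻ ω, ‖Y 0 ω‖ₑ ∂P := by
  have hm := h.measurable
  have h1 : Measurable fun ω s => Y (s + t) ω := measurable_pi_lambda _ fun s => hm _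
  have h2 : Measurable fun ω s => Y s ω := measurable_pi_lambda _ fun s => hm _
  have hf : Measurable fun x : ℤ → ℝ => ‖x 0‖ₑ := (measurable_pi_apply 0).enorm
  have h3 := congrArg (fun μ => ∫⁻ x, ‖x 0‖ₑ ∂μ) (h.stationary t)
  simp only [lintegral_map hf h1, lintegral_map hf h2, zero_add] at h3
  exact h3

theorem boundedL1 (h : IsStationaryAR P φ Y Z) : BoundedL1 P fun t ω => (Y t ω : ℂ) := by
  refine ⟨fun t => (Complex.measurable_ofReal.comp (h.measurable t)).aemeasurable,
    ∫⁻ ω, ‖Y 0 ω‖ₑ ∂P, (h.integrable 0).2.ne, fun t => ?_⟩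
  rw [← h.lintegral_enorm t]
  refine lintegral_mono fun ω => le_of_eq ?_
  rw [← ofReal_norm, ← ofReal_norm, Complex.norm_real]

/-- The σ-algebra generated by the innovations up to time `t`. -/
@[reducible] def past (φ : EuclideanSpace ℝ (Fin d)) (Y : ℤ → Ω → ℝ) (t : ℤ) :
    MeasurableSpace Ω :=
  ⨆ s ∈ Set.Iic t, MeasurableSpace.comap (innovation φ Y s) inferInstance

theorem monotone_past : Monotone (past (Ω := Ω) φ Y) := fun _ _ h =>
  biSup_mono fun _ hs => le_trans hs h

/-- Causality: the model equation says that the polynomial `Q` in the backward shift maps `Y` to the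
innovations. The passage to `ℂ` is needed to split `Q` into linear factors. -/
theorem aestronglyMeasurable_past (h : IsStationaryAR P φ Y Z) (t : ℤ) :
    AEStronglyMeasurable[past φ Y t] (Y t) P := by
  set Q : Polynomial ℂ :=
    1 - ∑ k : Fin d, Polynomial.C (φ k : ℂ) * Polynomial.X ^ ((k : ℕ) + 1) with hQ
  have hpow : ∀ (k : ℕ) (V : ℤ → Ω → ℂ) (t : ℤ), (backshift Ω ^ k) V t = V (t - k) := by
    intro k
    induction k with
    | zero => simp
    | succ k ih =>
      intro V t
      rw [pow_succ, Module.End.mul_apply, ih]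
      change V _ = V _
      congr 1
      push_cast
      ring
  have hQY : ∀ t, Polynomial.aeval (backshift Ω) Q (fun t ω => (Y t ω : ℂ)) t =
      fun ω => (innovation φ Y t ω : ℂ) := by
    intro t
    ext ω
    simp only [hQ, map_sub, map_one, map_sum, map_mul, Polynomial.aeval_C, map_pow,
      Polynomial.aeval_X, LinearMap.sub_apply, Module.End.one_apply, LinearMap.sum_apply,
      Module.End.mul_apply, Module.algebraMap_end_apply, Pi.sub_apply, Finset.sum_apply,
      Pi.smul_apply, hpow, innovation, smul_eq_mul]
    push_cast
    rfl
  have h1 : AEStronglyMeasurable[past φ Y t] (fun ω => (Y t ω : ℂ)) P := by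
    refine aestronglyMeasurable_of_aeval_backshift monotone_past (Q := Q) (fun z hz => ?_)
      h.boundedL1 (fun t => ?_) t
    · have := h.no_root z hz
      simpa [hQ, Polynomial.eval_finsetSum] using this
    · rw [hQY t]
      have h2 : Measurable[past φ Y t] (innovation φ Y t) :=
        (comap_measurable _).mono
          (le_iSup₂_of_le (f := fun s (_ : s ∈ Set.Iic t) =>
            MeasurableSpace.comap (innovation φ Y s) inferInstance) t (Set.self_mem_Iic) le_rfl) le_rfl
      exact (Complex.measurable_ofReal.comp h2).stronglyMeasurable.aestronglyMeasurable
  exact (Complex.continuous_re.comp_aestronglyMeasurable h1).congr (ae_of_all _ fun ω => by simp)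

theorem indep_past [IsProbabilityMeasure P] (h : IsStationaryAR P φ Y Z) (t : ℤ) :
    Indep (past φ Y (t - 1)) (MeasurableSpace.comap (innovation φ Y t) inferInstance) P := by
  have h1 : iIndepFun (innovation φ Y) P := h.innovations_indep.congr h.ae_eq_innovation
  have h2 := indep_iSup_of_disjoint (fun s => (h.measurable_innovation s).comap_le) h1
    (S := Set.Iic (t - 1)) (T := {t}) (by simp)
  rwa [iSup_singleton] at h2

/-- The innovation at time `t` is independent of the observations before time `t`. -/
theorem indep_arFiltration [IsProbabilityMeasure P] (h : IsStationaryAR P φ Y Z) (n : ℕ) (t : ℤ) :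
    Indep (arFiltration Y n (t - 1))
      (MeasurableSpace.comap (innovation φ Y t) inferInstance) P := by
  set I := Set.Icc (-((n : ℤ) - 1)) (t - 1)
  -- Each `Y s` is only almost surely equal to a function of past innovations. As `I` is countable,
  -- versions can be chosen simultaneously, and independence is insensitive to null sets.
  have hae : ∀ s : I, AEStronglyMeasurable[past φ Y (t - 1)] (Y s) P := fun s =>
    (h.aestronglyMeasurable_past s).mono (monotone_past s.2.2)
  set g : Ω → I → ℝ := fun ω s => (hae s).mk (Y s) ω with hg
  have hgm : Measurable[past φ Y (t - 1)] g :=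
    @measurable_pi_lambda _ _ _ (past φ Y (t - 1)) _ g
      fun s => (hae s).stronglyMeasurable_mk.measurable
  have hfg : g =ᵐ[P] fun ω (s : I) => Y s ω := by
    have : ∀ᵐ ω ∂P, ∀ s : I, Y s ω = (hae s).mk (Y s) ω :=
      ae_all_iff.2 fun s => (hae s).ae_eq_mk
    filter_upwards [this] with ω hω
    ext s
    exact (hω s).symm
  have h1 : IndepFun g (innovation φ Y t) P :=
    indep_of_indep_of_le_left (h.indep_past t) hgm.comap_le
  have h2 : IndepFun (fun ω (s : I) => Y s ω) (innovation φ Y t) P :=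
    h1.congr hfg (ae_eq_refl _)
  refine indep_of_indep_of_le_left h2 (iSup₂_le fun s hs => ?_)
  have h3 : Measurable[MeasurableSpace.comap (fun ω (s : I) => Y s ω) inferInstance] (Y s) :=
    (measurable_pi_apply (⟨s, hs⟩ : I)).comp (comap_measurable fun ω (s : I) => Y s ω)
  exact h3.comap_le

end IsStationaryAR

/-! ### Contracting stochastic approximation schemes -/

/-- The term `x` integrates to zero against centered noise, so noise bounded by `1` has exponential
moment at most `exp (x²)`. -/
theorem exp_le_add_exp_sq (x : ℝ) : Real.exp x ≤ x + Real.exp (x ^ 2) := by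
  have h1 := Real.add_one_le_exp (x ^ 2)
  by_cases hx : |x| ≤ 1
  · have := (abs_le.1 (Real.abs_exp_sub_one_sub_id_le hx)).2
    linarith
  · rcases lt_abs.1 (not_le.1 hx) with h | h
    · have : Real.exp x ≤ Real.exp (x ^ 2) := Real.exp_le_exp.2 (by nlinarith)
      linarith
    · have : Real.exp x ≤ 1 := Real.exp_le_one_iff.2 (by linarith)
      nlinarith

/-- This lets an additive drift leave the moment as a factor. Using `cosh` instead of `exp` handles
both tails and depends only on absolute values. -/
theorem cosh_add_le {x y : ℝ} (hy : 0 ≤ y) : Real.cosh (x + y) ≤ Real.exp y * Real.cosh x := by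
  have h1 : Real.exp (-x - y) ≤ Real.exp (-x + y) := Real.exp_le_exp.2 (by linarith)
  rw [Real.cosh_eq, Real.cosh_eq, neg_add', Real.exp_add x]
  rw [Real.exp_add] at h1
  nlinarith

theorem eventually_rpow_neg_le {β a : ℝ} (hβ : 0 < β) (ha : 0 < a) :
    ∀ᶠ s : ℕ in atTop, (s : ℝ) ^ (-β) ≤ a :=
  ((tendsto_rpow_neg_atTop hβ).comp tendsto_natCast_atTop_atTop).eventually_le_const ha

/-- The powers `s ^ (-p)`, `0 ≤ p ≤ 1`, decay more slowly than the products of `1 - a s ^ (-β)`. -/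
theorem eventually_rpow_mul_le {β a : ℝ} (hβ : β < 1) (ha : 0 < a) :
    ∀ᶠ s : ℕ in atTop, ∀ p ∈ Set.Icc (0 : ℝ) 1,
      (1 - a * (s : ℝ) ^ (-β)) * (s : ℝ) ^ (-p) ≤ ((s + 1 : ℕ) : ℝ) ^ (-p) := by
  filter_upwards [eventually_rpow_neg_le (sub_pos.2 hβ) ha, eventually_ge_atTop 1]
    with s hs h1 p hp
  have hs0 : (0 : ℝ) < s := by exact_mod_cast h1
  -- As `β < 1`, the contraction `a s^{-β}` eventually exceeds `1/s`, and `1 - 1/s ≤ s/(s+1) ≤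
  -- (s/(s+1))^p` for `p ≤ 1`.
  have h2 : ((s : ℝ))⁻¹ ≤ a * (s : ℝ) ^ (-β) := by
    rw [← Real.rpow_neg_one, show (-1 : ℝ) = -(1 - β) + -β by ring, Real.rpow_add hs0]
    exact mul_le_mul_of_nonneg_right hs (by positivity)
  have h3 : 1 - a * (s : ℝ) ^ (-β) ≤ ((s : ℝ) / (s + 1)) ^ p := by
    calc 1 - a * (s : ℝ) ^ (-β) ≤ 1 - (s : ℝ)⁻¹ := by linarith
      _ ≤ (s : ℝ) / (s + 1) := by
        rw [le_div_iff₀ (by linarith)]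
        field_simp
        linarith
      _ = ((s : ℝ) / (s + 1)) ^ (1 : ℝ) := (Real.rpow_one _).symm
      _ ≤ _ := Real.rpow_le_rpow_of_exponent_ge (by positivity)
          ((div_le_one (by linarith)).2 (by linarith)) hp.2
  calc (1 - a * (s : ℝ) ^ (-β)) * (s : ℝ) ^ (-p)
      ≤ ((s : ℝ) / (s + 1)) ^ p * (s : ℝ) ^ (-p) := by gcongr
    _ = ((s + 1 : ℕ) : ℝ) ^ (-p) := by
      rw [Real.div_rpow hs0.le (by linarith), Real.rpow_neg hs0.le, Real.rpow_neg (by positivity)]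
      push_cast
      have : (s : ℝ) ^ p ≠ 0 := (Real.rpow_pos_of_pos hs0 p).ne'
      field_simp

/-- A bounded recursion `e_{t+1} = u_t + γ_t ξ_t` with steps `γ_t = c t ^ (-β)`, centered bounded
noise `ξ`, and a drift that contracts at rate `κ γ_t` up to the bias `b_t`. Here `m t` is the
information available before the observation at time `t`. -/
structure IsContractingScheme {Ω : Type*} [m0 : MeasurableSpace Ω] (P : Measure Ω)
    (m : ℕ → MeasurableSpace Ω) (e u ξ b : ℕ → Ω → ℝ) (κ c β M : ℝ) : Prop where
  le : ∀ t, m t ≤ m0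
  mono : Monotone m
  measurable_e : ∀ t, 1 ≤ t → Measurable[m t] (e t)
  measurable_u : ∀ t, 1 ≤ t → Measurable[m t] (u t)
  measurable_b : ∀ t, 1 ≤ t → Measurable[m t] (b t)
  measurable_ξ : ∀ t, 1 ≤ t → Measurable (ξ t)
  condExp_ξ : ∀ t, 1 ≤ t → P[ξ t | m t] =ᵐ[P] 0
  abs_ξ_le : ∀ t ω, 1 ≤ t → |ξ t ω| ≤ 1
  abs_e_le : ∀ t ω, 1 ≤ t → |e t ω| ≤ M
  b_nonneg : ∀ t ω, 1 ≤ t → 0 ≤ b t ω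
  b_le : ∀ t ω, 1 ≤ t → b t ω ≤ 1
  recursion : ∀ t ω, 1 ≤ t → e (t + 1) ω = u t ω + c * (t : ℝ) ^ (-β) * ξ t ω
  abs_u_le : ∀ (t : ℕ) ω, 1 ≤ t → c * (t : ℝ) ^ (-β) ≤ 1 →
    |u t ω| ≤ (1 - κ * (c * (t : ℝ) ^ (-β))) * |e t ω| + c * (t : ℝ) ^ (-β) * b t ω
  κ_pos : 0 < κ
  κ_le : κ ≤ 1
  c_pos : 0 < c
  β_mem : β ∈ Set.Ioo (0 : ℝ) 1

theorem integral_mul_eq_zero_of_condExp {Ω : Type*} {m m0 : MeasurableSpace Ω} {P : Measure Ω}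
    [IsProbabilityMeasure P] (hm : m ≤ m0) {ξ g : Ω → ℝ} (hξm : Measurable ξ)
    (hξ : P[ξ | m] =ᵐ[P] 0) {C K : ℝ} (hC : ∀ ω, |ξ ω| ≤ C) (hg : Measurable[m] g)
    (hK : ∀ ω, |g ω| ≤ K) : ∫ ω, g ω * ξ ω ∂P = 0 := by
  have hξi : Integrable ξ P := .of_bound hξm.aestronglyMeasurable C (ae_of_all _ hC)
  have hgξ : Integrable (g * ξ) P :=
    hξi.bdd_mul (hg.mono hm le_rfl).aestronglyMeasurable (ae_of_all _ hK)
  have h1 := condExp_mul_of_stronglyMeasurable_left hg.stronglyMeasurable hgξ hξi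
  change ∫ ω, (g * ξ) ω ∂P = 0
  rw [← integral_condExp hm, integral_congr_ae (g := fun _ => (0 : ℝ)), integral_zero]
  filter_upwards [h1, hξ] with ω h2 h3
  rw [h2, Pi.mul_apply, h3, Pi.zero_apply, mul_zero]

theorem integral_mul_exp_le_of_condExp {Ω : Type*} {m m0 : MeasurableSpace Ω} {P : Measure Ω}
    [IsProbabilityMeasure P] (hm : m ≤ m0) {ξ g : Ω → ℝ} (hξm : Measurable ξ)
    (hξ : P[ξ | m] =ᵐ[P] 0) (hC : ∀ ω, |ξ ω| ≤ 1) (hg : Measurable[m] g) {K : ℝ}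
    (hg0 : ∀ ω, 0 ≤ g ω) (hK : ∀ ω, g ω ≤ K) (x : ℝ) :
    ∫ ω, g ω * Real.exp (x * ξ ω) ∂P ≤ Real.exp (x ^ 2) * ∫ ω, g ω ∂P := by
  have hgm : Measurable g := hg.mono hm le_rfl
  have hgK : ∀ ω, ‖g ω‖ ≤ K := fun ω => by rw [Real.norm_of_nonneg (hg0 ω)]; exact hK ω
  have hgi : Integrable g P := .of_bound hgm.aestronglyMeasurable K (ae_of_all _ hgK)
  have hξi : Integrable ξ P := .of_bound hξm.aestronglyMeasurable 1 (ae_of_all _ hC)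
  have hgξ : Integrable (fun ω => g ω * ξ ω) P :=
    hξi.bdd_mul hgm.aestronglyMeasurable (ae_of_all _ hgK)
  have h0 := integral_mul_eq_zero_of_condExp hm hξm hξ hC hg hgK
  calc ∫ ω, g ω * Real.exp (x * ξ ω) ∂P
      ≤ ∫ ω, (x * (g ω * ξ ω) + Real.exp (x ^ 2) * g ω) ∂P := by
        refine integral_mono_of_nonneg (ae_of_all _ fun ω => ?_)
          ((hgξ.const_mul x).add (hgi.const_mul _)) (ae_of_all _ fun ω => ?_)
        · exact mul_nonneg (hg0 ω) (Real.exp_nonneg _)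
        · have h1 : Real.exp ((x * ξ ω) ^ 2) ≤ Real.exp (x ^ 2) := by
            apply Real.exp_le_exp.2
            rw [mul_pow]
            have := sq_le_one_iff_abs_le_one (ξ ω) |>.2 (hC ω)
            nlinarith [sq_nonneg x]
          have h2 := mul_le_mul_of_nonneg_left
            ((exp_le_add_exp_sq (x * ξ ω)).trans (add_le_add_right h1 _)) (hg0 ω)
          dsimp only
          linarith
    _ = Real.exp (x ^ 2) * ∫ ω, g ω ∂P := by
        rw [integral_add (hgξ.const_mul x) (hgi.const_mul _), integral_const_mul, h0,
          integral_const_mul]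
        ring

/-! ### Second moments of the scheme -/

namespace IsContractingScheme

variable {Ω : Type*} {m0 : MeasurableSpace Ω} {P : Measure Ω}
  {m : ℕ → MeasurableSpace Ω} {e u ξ b : ℕ → Ω → ℝ} {κ c β M : ℝ}

theorem eventually_step_le (h : IsContractingScheme P m e u ξ b κ c β M) :
    ∀ᶠ t : ℕ in atTop, c * (t : ℝ) ^ (-β) ≤ 1 := by
  filter_upwards [eventually_rpow_neg_le h.β_mem.1 (inv_pos.2 h.c_pos)] with t ht
  calc c * (t : ℝ) ^ (-β) ≤ c * c⁻¹ := mul_le_mul_of_nonneg_left ht h.c_pos.le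
    _ = 1 := mul_inv_cancel₀ h.c_pos.ne'

theorem step_nonneg (h : IsContractingScheme P m e u ξ b κ c β M) (t : ℕ) :
    0 ≤ c * (t : ℝ) ^ (-β) := by
  have := h.c_pos
  positivity

theorem M_nonneg [IsProbabilityMeasure P] (h : IsContractingScheme P m e u ξ b κ c β M) : 0 ≤ M := by
  obtain ⟨ω⟩ := P.nonempty_of_neZero
  exact (abs_nonneg _).trans (h.abs_e_le 1 ω le_rfl)

theorem abs_u_le_const (h : IsContractingScheme P m e u ξ b κ c β M) {t : ℕ} (ht : 1 ≤ t)
    (hγ : c * (t : ℝ) ^ (-β) ≤ 1) (ω : Ω) : |u t ω| ≤ M + 1 := by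
  have h0 := h.step_nonneg t
  set γ := c * (t : ℝ) ^ (-β)
  have h1 := h.abs_u_le t ω ht hγ
  have h2 : (1 - κ * γ) * |e t ω| ≤ 1 * M := by
    refine mul_le_mul ?_ (h.abs_e_le t ω ht) (abs_nonneg _) zero_le_one
    have := mul_nonneg h.κ_pos.le h0
    linarith
  have h3 : γ * b t ω ≤ 1 * 1 := mul_le_mul hγ (h.b_le t ω ht) (h.b_nonneg t ω ht) zero_le_one
  linarith

/-- The cross term with the noise has mean zero. The squared drift is bounded by convexity: it is at
most the square of the average of `|e|` and `b / κ` with weights `1 - κγ` and `κγ`. -/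
theorem integral_sq_succ_le [IsProbabilityMeasure P] (h : IsContractingScheme P m e u ξ b κ c β M) {t : ℕ} (ht : 1 ≤ t)
    (hγ : c * (t : ℝ) ^ (-β) ≤ 1) :
    ∫ ω, e (t + 1) ω ^ 2 ∂P ≤ (1 - κ * (c * (t : ℝ) ^ (-β))) * ∫ ω, e t ω ^ 2 ∂P +
      c * (t : ℝ) ^ (-β) / κ * ∫ ω, b t ω ^ 2 ∂P + (c * (t : ℝ) ^ (-β)) ^ 2 := by
  have h0 := h.step_nonneg t
  have hκ := h.κ_pos
  have hub := h.abs_u_le_const ht hγ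
  have hu := h.abs_u_le t
  have hrec := h.recursion t
  set γ := c * (t : ℝ) ^ (-β)
  have hem := (h.measurable_e t ht).mono (h.le t) le_rfl
  have hum := (h.measurable_u t ht).mono (h.le t) le_rfl
  have hbm := (h.measurable_b t ht).mono (h.le t) le_rfl
  have hξm := h.measurable_ξ t ht
  have hei : Integrable (fun ω => e t ω ^ 2) P :=
    .of_bound (hem.pow_const 2).aestronglyMeasurable (M ^ 2) (ae_of_all _ fun ω => by
      rw [norm_pow]; exact pow_le_pow_left₀ (norm_nonneg _) (h.abs_e_le t ω ht) 2)
  have hbi : Integrable (fun ω => b t ω ^ 2) P :=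
    .of_bound (hbm.pow_const 2).aestronglyMeasurable (1 ^ 2) (ae_of_all _ fun ω => by
      rw [norm_pow]
      refine pow_le_pow_left₀ (norm_nonneg _) ?_ 2
      rw [Real.norm_of_nonneg (h.b_nonneg t ω ht)]
      exact h.b_le t ω ht)
  have hξi : Integrable (ξ t) P :=
    .of_bound hξm.aestronglyMeasurable 1 (ae_of_all _ fun ω => h.abs_ξ_le t ω ht)
  have huξ : Integrable (fun ω => u t ω * ξ t ω) P :=
    hξi.bdd_mul hum.aestronglyMeasurable (ae_of_all _ hub)
  have hz := integral_mul_eq_zero_of_condExp (h.le t) hξm (h.condExp_ξ t ht)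
    (fun ω => h.abs_ξ_le t ω ht) (h.measurable_u t ht) hub
  have hI1 : Integrable (fun ω => (1 - κ * γ) * e t ω ^ 2 + γ / κ * b t ω ^ 2) P := (hei.const_mul (1 - κ * γ)).add (hbi.const_mul (γ / κ))
  have hI2 : Integrable (fun ω => (1 - κ * γ) * e t ω ^ 2 + γ / κ * b t ω ^ 2 +
      2 * γ * (u t ω * ξ t ω)) P := hI1.add (huξ.const_mul (2 * γ))
  calc ∫ ω, e (t + 1) ω ^ 2 ∂P
      ≤ ∫ ω, ((1 - κ * γ) * e t ω ^ 2 + γ / κ * b t ω ^ 2 + 2 * γ * (u t ω * ξ t ω) + γ ^ 2) ∂P := by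
        refine integral_mono_of_nonneg (ae_of_all _ fun ω => sq_nonneg _)
          (hI2.add (integrable_const (γ ^ 2))) (ae_of_all _ fun ω => ?_)
        have h1 : u t ω ^ 2 ≤ (1 - κ * γ) * e t ω ^ 2 + γ / κ * b t ω ^ 2 := by
          have hκγ : κ * γ ≤ 1 := by nlinarith [h.κ_le]
          have h2 : u t ω ^ 2 ≤ ((1 - κ * γ) * |e t ω| + γ * b t ω) ^ 2 := by
            rw [← sq_abs (u t ω)]
            exact pow_le_pow_left₀ (abs_nonneg _) (hu ω ht hγ) 2
          have h3 : (1 - κ * γ) * e t ω ^ 2 + γ / κ * b t ω ^ 2 -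
              ((1 - κ * γ) * |e t ω| + γ * b t ω) ^ 2 =
              (1 - κ * γ) * (κ * γ) * (|e t ω| - b t ω / κ) ^ 2 := by
            rw [← sq_abs (e t ω)]
            field_simp
            ring
          have h4 : 0 ≤ (1 - κ * γ) * (κ * γ) * (|e t ω| - b t ω / κ) ^ 2 :=
            mul_nonneg (mul_nonneg (by linarith) (by positivity)) (sq_nonneg _)
          linarith
        have h5 : ξ t ω ^ 2 ≤ 1 := sq_le_one_iff_abs_le_one _ |>.2 (h.abs_ξ_le t ω ht)
        dsimp only
        rw [hrec ω ht]
        nlinarith [mul_le_mul_of_nonneg_left h5 (sq_nonneg γ)]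
    _ = _ := by
        rw [integral_add hI2 (integrable_const _), integral_add hI1 (huξ.const_mul _),
          integral_add (hei.const_mul _) (hbi.const_mul _), integral_const_mul, integral_const_mul,
          integral_const_mul, hz]
        simp

/-- Induction on the bound `K t^{-β}`. Half of the contraction absorbs the bias and noise terms,
both of order `t^{-2β}`, and the other half pays for the decrease of `t^{-β}`. -/
theorem exists_integral_sq_le [IsProbabilityMeasure P] (h : IsContractingScheme P m e u ξ b κ c β M) {C : ℝ}
    (hb : ∀ᶠ t : ℕ in atTop, ∫ ω, b t ω ^ 2 ∂P ≤ C * (t : ℝ) ^ (-(1 : ℝ))) :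
    ∃ K : ℝ, 0 < K ∧ ∀ᶠ t : ℕ in atTop, ∫ ω, e t ω ^ 2 ∂P ≤ K * (t : ℝ) ^ (-β) := by
  have hκ := h.κ_pos
  have hc := h.c_pos
  have ha : 0 < κ * c / 2 := by positivity
  obtain ⟨s0, hs0⟩ := eventually_atTop.1 ((eventually_rpow_mul_le h.β_mem.2 ha).and
    (hb.and (h.eventually_step_le.and (eventually_ge_atTop 1))))
  have hs1 : 1 ≤ s0 := (hs0 s0 le_rfl).2.2.2
  -- The first summand gives the absorption `hK1`; the second makes the bound trivial at `s0`, where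
  -- `|e| ≤ M`.
  set K := 2 / κ * (|C| / κ + c) + M ^ 2 * (s0 : ℝ) ^ β with hK
  have hK1 : |C| / κ + c ≤ κ * K / 2 := by
    rw [hK]
    have h1 : κ * (2 / κ * (|C| / κ + c) + M ^ 2 * (s0 : ℝ) ^ β) / 2 =
        |C| / κ + c + κ * (M ^ 2 * (s0 : ℝ) ^ β) / 2 := by field_simp
    have h2 : 0 ≤ κ * (M ^ 2 * (s0 : ℝ) ^ β) := by positivity
    linarith
  refine ⟨K, by positivity, eventually_atTop.2 ⟨s0, fun t ht => ?_⟩⟩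
  induction t, ht using Nat.le_induction with
  | base =>
    have hpos : (0 : ℝ) < s0 := by exact_mod_cast hs1
    calc ∫ ω, e s0 ω ^ 2 ∂P ≤ ∫ _, M ^ 2 ∂P := by
          refine integral_mono_of_nonneg (ae_of_all _ fun ω => sq_nonneg _)
            (integrable_const _) (ae_of_all _ fun ω => ?_)
          dsimp only
          rw [← sq_abs]
          exact pow_le_pow_left₀ (abs_nonneg _) (h.abs_e_le s0 ω hs1) 2
      _ = M ^ 2 * (s0 : ℝ) ^ β * (s0 : ℝ) ^ (-β) := by
          rw [mul_assoc, ← Real.rpow_add hpos]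
          simp
      _ ≤ K * (s0 : ℝ) ^ (-β) := by
          gcongr
          rw [hK]
          have : 0 ≤ 2 / κ * (|C| / κ + c) := by positivity
          linarith
  | succ t ht ih =>
    obtain ⟨h1, h2, h3, h4⟩ := hs0 t ht
    have hpos : (1 : ℝ) ≤ t := by exact_mod_cast h4
    have h5 := h.integral_sq_succ_le h4 h3
    have h6 := h1 β ⟨h.β_mem.1.le, h.β_mem.2.le⟩
    have h7 : (t : ℝ) ^ (-(1 : ℝ)) ≤ (t : ℝ) ^ (-β) :=
      Real.rpow_le_rpow_of_exponent_le hpos (by linarith [h.β_mem.2])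
    have hx : 0 < (t : ℝ) ^ (-β) := by positivity
    set x := (t : ℝ) ^ (-β)
    have h8 : ∫ ω, b t ω ^ 2 ∂P ≤ |C| * x :=
      h2.trans (mul_le_mul (le_abs_self C) h7 (by positivity) (abs_nonneg C))
    have hκγ : 0 ≤ 1 - κ * (c * x) := by
      nlinarith [h.κ_le, mul_pos hc hx]
    calc ∫ ω, e (t + 1) ω ^ 2 ∂P
        ≤ (1 - κ * (c * x)) * (K * x) + c * x / κ * (|C| * x) + (c * x) ^ 2 := by
          refine h5.trans ?_
          gcongr
      _ = (1 - κ * (c * x)) * (K * x) + c * x ^ 2 * (|C| / κ + c) := by ring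
      _ ≤ (1 - κ * (c * x)) * (K * x) + c * x ^ 2 * (κ * K / 2) := by gcongr
      _ = K * ((1 - κ * c / 2 * x) * x) := by ring
      _ ≤ K * ((t + 1 : ℕ) : ℝ) ^ (-β) := by gcongr

end IsContractingScheme

/-! ### Exponential moments on the small-bias event -/

namespace IsContractingScheme

variable {Ω : Type*} {m0 : MeasurableSpace Ω} {P : Measure Ω}
  {m : ℕ → MeasurableSpace Ω} {e u ξ b : ℕ → Ω → ℝ} {κ c β M : ℝ}

/-- The noise costs `exp (l²γ²)`, the bias costs `exp (lγε)`, and the contraction rescales `l`.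
Since `S` is known at time `t`, its indicator may be kept inside the conditioning. -/
theorem setIntegral_cosh_succ_le [IsProbabilityMeasure P]
    (h : IsContractingScheme P m e u ξ b κ c β M) {t : ℕ} (ht : 1 ≤ t)
    (hγ : c * (t : ℝ) ^ (-β) ≤ 1) {S : Set Ω} (hS : MeasurableSet[m t] S) {ε : ℝ} (hε : 0 ≤ ε)
    (hSε : ∀ ω ∈ S, b t ω ≤ ε) {l : ℝ} (hl : 0 ≤ l) :
    ∫ ω in S, Real.cosh (l * e (t + 1) ω) ∂P ≤
      Real.exp (l ^ 2 * (c * (t : ℝ) ^ (-β)) ^ 2 + l * (c * (t : ℝ) ^ (-β)) * ε) *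
        ∫ ω in S, Real.cosh (l * (1 - κ * (c * (t : ℝ) ^ (-β))) * e t ω) ∂P := by
  have h0 := h.step_nonneg t
  have hκ := h.κ_pos
  have hub := h.abs_u_le_const ht hγ
  have hu := h.abs_u_le t
  have hrec := h.recursion t
  set γ := c * (t : ℝ) ^ (-β)
  have hκγ : 0 ≤ 1 - κ * γ := by nlinarith [h.κ_le]
  have hS0 : MeasurableSet S := h.le t _ hS
  have hem := (h.measurable_e t ht).mono (h.le t) le_rfl
  have hum := (h.measurable_u t ht).mono (h.le t) le_rfl
  have hξm := h.measurable_ξ t ht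
  -- Applied with `x = l` and `x = -l`, the two exponentials that make up `cosh`.
  have key : ∀ x : ℝ, |x| = l →
      Integrable (fun ω => S.indicator (fun ω => Real.exp (x * u t ω)) ω *
        Real.exp (x * γ * ξ t ω)) P ∧
      Integrable (fun ω => S.indicator (fun ω => Real.exp (x * u t ω)) ω) P ∧
      ∫ ω, S.indicator (fun ω => Real.exp (x * u t ω)) ω * Real.exp (x * γ * ξ t ω) ∂P ≤
        Real.exp (l ^ 2 * γ ^ 2) *
          ∫ ω, S.indicator (fun ω => Real.exp (x * u t ω)) ω ∂P := by
    intro x hx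
    have hgm : Measurable[m t] (S.indicator fun ω => Real.exp (x * u t ω)) :=
      (Real.measurable_exp.comp ((h.measurable_u t ht).const_mul x)).indicator hS
    have hg0 : ∀ ω, 0 ≤ S.indicator (fun ω => Real.exp (x * u t ω)) ω := fun ω =>
      Set.indicator_nonneg (fun _ _ => Real.exp_nonneg _) ω
    have hgK : ∀ ω, S.indicator (fun ω => Real.exp (x * u t ω)) ω ≤ Real.exp (l * (M + 1)) := by
      intro ω
      refine Set.indicator_le' (fun ω _ => ?_) (fun _ _ => Real.exp_nonneg _) ω
      apply Real.exp_le_exp.2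
      calc x * u t ω ≤ |x| * |u t ω| := by rw [← abs_mul]; exact le_abs_self _
        _ ≤ l * (M + 1) := by rw [hx]; exact mul_le_mul_of_nonneg_left (hub ω) hl
    have hgi : Integrable (S.indicator fun ω => Real.exp (x * u t ω)) P :=
      .of_bound (hgm.mono (h.le t) le_rfl).aestronglyMeasurable _ (ae_of_all _ fun ω => by
        rw [Real.norm_of_nonneg (hg0 ω)]; exact hgK ω)
    refine ⟨?_, hgi, ?_⟩
    · refine hgi.mul_bdd (c := Real.exp (l * γ)) (by fun_prop) (ae_of_all _ fun ω => ?_)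
      rw [Real.norm_of_nonneg (Real.exp_nonneg _)]
      apply Real.exp_le_exp.2
      calc x * γ * ξ t ω ≤ |x * γ| * |ξ t ω| := by rw [← abs_mul]; exact le_abs_self _
        _ ≤ |x * γ| * 1 := mul_le_mul_of_nonneg_left (h.abs_ξ_le t ω ht) (abs_nonneg _)
        _ = l * γ := by rw [mul_one, abs_mul, hx, abs_of_nonneg h0]
    · have := integral_mul_exp_le_of_condExp (h.le t) hξm (h.condExp_ξ t ht)
        (fun ω => h.abs_ξ_le t ω ht) hgm hg0 hgK (x * γ)
      rwa [mul_pow, ← sq_abs x, hx] at this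
  obtain ⟨i1, j1, k1⟩ := key l (abs_of_nonneg hl)
  obtain ⟨i2, j2, k2⟩ := key (-l) (by rw [abs_neg, abs_of_nonneg hl])
  calc ∫ ω in S, Real.cosh (l * e (t + 1) ω) ∂P
      = (∫ ω, S.indicator (fun ω => Real.exp (l * u t ω)) ω * Real.exp (l * γ * ξ t ω) ∂P +
          ∫ ω, S.indicator (fun ω => Real.exp (-l * u t ω)) ω *
            Real.exp (-l * γ * ξ t ω) ∂P) / 2 := by
        rw [← integral_add i1 i2, ← integral_div, ← integral_indicator hS0]
        refine integral_congr_ae (ae_of_all _ fun ω => ?_)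
        by_cases hω : ω ∈ S
        · simp only [Set.indicator_of_mem hω, ← Real.exp_add, Real.cosh_eq, hrec ω ht]
          ring_nf
        · simp [hω]
    _ ≤ Real.exp (l ^ 2 * γ ^ 2) *
        ((∫ ω, S.indicator (fun ω => Real.exp (l * u t ω)) ω ∂P +
          ∫ ω, S.indicator (fun ω => Real.exp (-l * u t ω)) ω ∂P) / 2) := by linarith
    _ = Real.exp (l ^ 2 * γ ^ 2) * ∫ ω in S, Real.cosh (l * u t ω) ∂P := by
        congr 1
        rw [← integral_add j1 j2, ← integral_div, ← integral_indicator hS0]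
        refine integral_congr_ae (ae_of_all _ fun ω => ?_)
        by_cases hω : ω ∈ S
        · simp only [Set.indicator_of_mem hω, Real.cosh_eq, neg_mul]
        · simp [hω]
    _ ≤ Real.exp (l ^ 2 * γ ^ 2) * ∫ ω in S, Real.exp (l * γ * ε) *
          Real.cosh (l * (1 - κ * γ) * e t ω) ∂P := by
        refine mul_le_mul_of_nonneg_left ?_ (Real.exp_nonneg _)
        refine setIntegral_mono_on ?_ ?_ hS0 fun ω hω => ?_
        · refine (Integrable.of_bound (C := Real.cosh (l * (M + 1))) (by fun_prop)
            (ae_of_all _ fun ω => ?_)).integrableOn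
          rw [Real.norm_of_nonneg (Real.cosh_pos _).le, Real.cosh_le_cosh, abs_mul,
            abs_of_nonneg hl]
          exact (mul_le_mul_of_nonneg_left (hub ω) hl).trans (le_abs_self _)
        · refine ((Integrable.of_bound (C := Real.cosh (l * (1 - κ * γ) * M)) (by fun_prop)
            (ae_of_all _ fun ω => ?_)).const_mul _).integrableOn
          rw [Real.norm_of_nonneg (Real.cosh_pos _).le, Real.cosh_le_cosh, abs_mul, abs_mul _ M]
          exact mul_le_mul_of_nonneg_left ((h.abs_e_le t ω ht).trans (le_abs_self M))
            (abs_nonneg _)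
        · have h1 : |l * u t ω| ≤ l * (1 - κ * γ) * |e t ω| + l * γ * ε := by
            rw [abs_mul, abs_of_nonneg hl]
            have h2 := hu ω ht hγ
            have h3 := mul_le_mul_of_nonneg_left (hSε ω hω) h0
            calc l * |u t ω| ≤ l * ((1 - κ * γ) * |e t ω| + γ * ε) :=
                  mul_le_mul_of_nonneg_left (by linarith) hl
              _ = _ := by ring
          calc Real.cosh (l * u t ω)
              ≤ Real.cosh (l * (1 - κ * γ) * |e t ω| + l * γ * ε) :=
                Real.cosh_le_cosh.2 (h1.trans (le_abs_self _))
            _ ≤ Real.exp (l * γ * ε) * Real.cosh (l * (1 - κ * γ) * |e t ω|) :=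
                cosh_add_le (by positivity)
            _ = _ := by
                rw [← Real.cosh_abs (l * (1 - κ * γ) * e t ω), abs_mul,
                  abs_of_nonneg (mul_nonneg hl hκγ)]
    _ = _ := by rw [integral_const_mul, ← mul_assoc, ← Real.exp_add]

/-- The event that the bias stays below `ε` on `[t₀, t)`. -/
def biasLe (b : ℕ → Ω → ℝ) (ε : ℕ → ℝ) (t₀ t : ℕ) : Set Ω :=
  {ω | ∀ r, t₀ ≤ r → r < t → b r ω ≤ ε r}

theorem measurableSet_biasLe (h : IsContractingScheme P m e u ξ b κ c β M) (ε : ℕ → ℝ) {t₀ : ℕ}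
    (ht₀ : 1 ≤ t₀) (t : ℕ) : MeasurableSet[m t] (biasLe b ε t₀ (t + 1)) := by
  have : biasLe b ε t₀ (t + 1) = ⋂ r ∈ Set.Icc t₀ t, {ω | b r ω ≤ ε r} := by
    ext ω
    simp [biasLe]
  rw [this]
  refine MeasurableSet.biInter (Set.to_countable _) fun r hr => ?_
  exact h.mono hr.2 _ (measurableSet_le (h.measurable_b r (ht₀.trans hr.1)) measurable_const)

/-- Exponential moment bound along sequences `A`, `L` that dominate the variance and the drift. -/
theorem setIntegral_cosh_le [IsProbabilityMeasure P]
    (h : IsContractingScheme P m e u ξ b κ c β M) {t₀ : ℕ} (ht₀ : 1 ≤ t₀)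
    (hγ : ∀ t, t₀ ≤ t → c * (t : ℝ) ^ (-β) ≤ 1) {ε A L : ℕ → ℝ} (hε : ∀ t, 0 ≤ ε t)
    (hA0 : 0 ≤ A t₀) (hL0 : M ≤ L t₀)
    (hA : ∀ t, t₀ ≤ t → (1 - κ * (c * (t : ℝ) ^ (-β))) * A t + (c * (t : ℝ) ^ (-β)) ^ 2 ≤ A (t + 1))
    (hA' : ∀ t, t₀ ≤ t → 0 ≤ A t)
    (hL : ∀ t, t₀ ≤ t →
      (1 - κ * (c * (t : ℝ) ^ (-β))) * L t + c * (t : ℝ) ^ (-β) * ε t ≤ L (t + 1))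
    {t : ℕ} (ht : t₀ ≤ t) {l : ℝ} (hl : 0 ≤ l) :
    ∫ ω in biasLe b ε t₀ t, Real.cosh (l * e t ω) ∂P ≤ Real.exp (l ^ 2 * A t + l * L t) := by
  have hcosh : ∀ t, t₀ ≤ t → ∀ l : ℝ, Integrable (fun ω => Real.cosh (l * e t ω)) P := by
    intro t ht l
    have hem := (h.measurable_e t (ht₀.trans ht)).mono (h.le t) le_rfl
    refine Integrable.of_bound (C := Real.cosh (l * M)) (by fun_prop) (ae_of_all _ fun ω => ?_)
    rw [Real.norm_of_nonneg (Real.cosh_pos _).le, Real.cosh_le_cosh, abs_mul, abs_mul]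
    exact mul_le_mul_of_nonneg_left ((h.abs_e_le t ω (ht₀.trans ht)).trans (le_abs_self M))
      (abs_nonneg _)
  -- The parameter `l` must vary: the preceding moment is needed at `l * (1 - κ * γ)`.
  induction t, ht using Nat.le_induction generalizing l with
  | base =>
    calc ∫ ω in biasLe b ε t₀ t₀, Real.cosh (l * e t₀ ω) ∂P
        ≤ ∫ ω, Real.cosh (l * e t₀ ω) ∂P :=
          setIntegral_le_integral (hcosh t₀ le_rfl l) (ae_of_all _ fun ω => (Real.cosh_pos _).le)
      _ ≤ ∫ _, Real.exp (l ^ 2 * A t₀ + l * L t₀) ∂P := by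
          refine integral_mono (hcosh t₀ le_rfl l) (integrable_const _) fun ω => ?_
          have h1 : |l * e t₀ ω| ≤ l * L t₀ := by
            rw [abs_mul, abs_of_nonneg hl]
            exact mul_le_mul_of_nonneg_left ((h.abs_e_le t₀ ω ht₀).trans hL0) hl
          have h2 := mul_nonneg (sq_nonneg l) hA0
          calc Real.cosh (l * e t₀ ω) ≤ Real.cosh (l * L t₀) :=
                Real.cosh_le_cosh.2 (h1.trans (le_abs_self _))
            _ ≤ Real.exp (l * L t₀) * Real.cosh 0 := by
                simpa using cosh_add_le (x := 0) ((abs_nonneg _).trans h1)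
            _ ≤ Real.exp (l ^ 2 * A t₀ + l * L t₀) := by
                rw [Real.cosh_zero, mul_one]
                exact Real.exp_le_exp.2 (by linarith)
      _ = _ := by simp
  | succ t ht ih =>
    have h1t := ht₀.trans ht
    have h0 := h.step_nonneg t
    have hstep := h.setIntegral_cosh_succ_le h1t (hγ t ht)
      (h.measurableSet_biasLe ε ht₀ t) (hε t) (fun ω hω => hω t ht (Nat.lt_succ_self t)) hl
    have hAt := hA t ht
    have hLt := hL t ht
    have hγt := hγ t ht
    set γ := c * (t : ℝ) ^ (-β)
    have hκγ : 0 ≤ 1 - κ * γ := by nlinarith [h.κ_le, h.κ_pos]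
    have hκγ1 : 1 - κ * γ ≤ 1 := by nlinarith [h.κ_pos]
    calc _ ≤ _ := hstep
      _ ≤ Real.exp (l ^ 2 * γ ^ 2 + l * γ * ε t) *
          ∫ ω in biasLe b ε t₀ t, Real.cosh (l * (1 - κ * γ) * e t ω) ∂P := by
          refine mul_le_mul_of_nonneg_left ?_ (Real.exp_nonneg _)
          refine setIntegral_mono_set (hcosh t ht _).integrableOn
            (ae_of_all _ fun ω => (Real.cosh_pos _).le) ?_
          -- The event at `t + 1` also constrains the bias at time `t`, so it lies inside the event
          -- at `t`.
          exact LE.le.eventuallyLE fun ω hω r hr hrt => hω r hr (hrt.trans t.lt_succ_self)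
      _ ≤ Real.exp (l ^ 2 * γ ^ 2 + l * γ * ε t) *
          Real.exp ((l * (1 - κ * γ)) ^ 2 * A t + l * (1 - κ * γ) * L t) :=
          mul_le_mul_of_nonneg_left (ih (mul_nonneg hl hκγ)) (Real.exp_nonneg _)
      _ ≤ Real.exp (l ^ 2 * A (t + 1) + l * L (t + 1)) := by
          rw [← Real.exp_add]
          apply Real.exp_le_exp.2
          -- Of the squared contraction only one factor is kept, to match the recursion assumed of
          -- `A`.
          have h2 : (1 - κ * γ) ^ 2 * A t ≤ (1 - κ * γ) * A t :=
            mul_le_mul_of_nonneg_right (by nlinarith) (hA' t ht)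
          have h3 := mul_le_mul_of_nonneg_left (h2.trans (by linarith : _ ≤ A (t + 1) - γ ^ 2))
            (sq_nonneg l)
          have h4 := mul_le_mul_of_nonneg_left hLt hl
          nlinarith

end IsContractingScheme

/-- Telescoping, from `1/n³ ≤ 1/((n-1) n (n+1))`, which is the difference of consecutive terms
`1/(2(n-1)n)`. -/
theorem sum_Ico_inv_cube_le {a n : ℕ} (ha : 2 ≤ a) (hn : a ≤ n) :
    ∑ r ∈ Finset.Ico a n, 1 / (r : ℝ) ^ 3 ≤
      1 / (2 * ((a : ℝ) - 1) * a) - 1 / (2 * ((n : ℝ) - 1) * n) := by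
  induction n, hn using Nat.le_induction with
  | base => simp
  | succ n hn ih =>
    rw [Finset.sum_Ico_succ_top hn]
    have h2 : (2 : ℝ) ≤ n := by exact_mod_cast ha.trans hn
    have h3 : 1 / (n : ℝ) ^ 3 ≤
        1 / (2 * ((n : ℝ) - 1) * n) - 1 / (2 * (((n + 1 : ℕ) : ℝ) - 1) * (n + 1 : ℕ)) := by
      have h4 : (0 : ℝ) < n - 1 := by linarith
      have h5 : (0 : ℝ) < n := by linarith
      push_cast
      rw [show 1 / (2 * ((n : ℝ) - 1) * n) - 1 / (2 * ((n : ℝ) + 1 - 1) * (n + 1)) =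
        1 / (n * ((n : ℝ) ^ 2 - 1)) by
          rw [show (n : ℝ) ^ 2 - 1 = (n - 1) * (n + 1) by ring, add_sub_cancel_right]
          field_simp
          ring]
      apply one_div_le_one_div_of_le
      · have : 0 < (n : ℝ) ^ 2 - 1 := by nlinarith
        positivity
      · nlinarith
    linarith

/-! ### Tail bounds and the rate in probability -/

namespace IsContractingScheme

variable {Ω : Type*} {m0 : MeasurableSpace Ω} {P : Measure Ω}
  {m : ℕ → MeasurableSpace Ω} {e u ξ b : ℕ → Ω → ℝ} {κ c β M : ℝ}

/-- Markov's inequality for `cosh (l * e t)`. The factor `2` comes from `cosh x ≥ exp x / 2`. -/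
theorem measureReal_inter_abs_e_ge_le [IsProbabilityMeasure P]
    (h : IsContractingScheme P m e u ξ b κ c β M) {t : ℕ} (ht : 1 ≤ t) {S : Set Ω}
    {l x v : ℝ} (hx : 0 ≤ x)
    (hv : ∫ ω in S, Real.cosh (l * e t ω) ∂P ≤ Real.exp v) :
    P.real (S ∩ {ω | x ≤ |e t ω|}) ≤ 2 * Real.exp (v - l * x) := by
  have hem := (h.measurable_e t ht).mono (h.le t) le_rfl
  have hcosh : Integrable (fun ω => Real.cosh (l * e t ω)) P := by
    refine Integrable.of_bound (C := Real.cosh (l * M)) (by fun_prop) (ae_of_all _ fun ω => ?_)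
    rw [Real.norm_of_nonneg (Real.cosh_pos _).le, Real.cosh_le_cosh, abs_mul, abs_mul]
    exact mul_le_mul_of_nonneg_left ((h.abs_e_le t ω ht).trans (le_abs_self M)) (abs_nonneg _)
  have h1 := mul_meas_ge_le_integral_of_nonneg (μ := P.restrict S)
    (ae_of_all _ fun ω => (Real.cosh_pos (l * e t ω)).le) hcosh.integrableOn (Real.cosh (l * x))
  have h2 : P.real (S ∩ {ω | x ≤ |e t ω|}) ≤
      (P.restrict S).real {ω | Real.cosh (l * x) ≤ Real.cosh (l * e t ω)} := by
    have hms : MeasurableSet {ω | Real.cosh (l * x) ≤ Real.cosh (l * e t ω)} :=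
      measurableSet_le measurable_const (by fun_prop)
    rw [measureReal_restrict_apply hms, Set.inter_comm]
    refine measureReal_mono (Set.inter_subset_inter_left _ fun ω hω => ?_)
    rw [Set.mem_ofPred_eq] at hω ⊢
    rw [Real.cosh_le_cosh, abs_mul, abs_mul, abs_of_nonneg hx]
    exact mul_le_mul_of_nonneg_left hω (abs_nonneg _)
  have h3 : Real.exp (l * x) / 2 ≤ Real.cosh (l * x) := by
    rw [Real.cosh_eq]
    have := Real.exp_pos (-(l * x))
    linarith
  have h4 : Real.exp (l * x) / 2 * P.real (S ∩ {ω | x ≤ |e t ω|}) ≤ Real.exp v :=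
    (mul_le_mul h3 h2 measureReal_nonneg (Real.cosh_pos _).le).trans (h1.trans hv)
  have h5 : Real.exp (v - l * x) * Real.exp (l * x) = Real.exp v := by
    rw [← Real.exp_add]
    congr 1
    ring
  rw [← h5] at h4
  have h6 := Real.exp_pos (l * x)
  refine le_of_mul_le_mul_right ?_ h6
  linarith

theorem measureReal_compl_biasLe_le [IsProbabilityMeasure P] {ε : ℕ → ℝ} {t₀ t : ℕ}
    (ht₀ : 2 ≤ t₀) (ht : t₀ ≤ t + 1)
    (hb : ∀ r, t₀ ≤ r → r ≤ t → P.real {ω | ε r < b r ω} ≤ 1 / (r : ℝ) ^ 3) :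
    P.real (biasLe b ε t₀ (t + 1))ᶜ ≤ 1 / (2 * ((t₀ : ℝ) - 1) * t₀) := by
  calc P.real (biasLe b ε t₀ (t + 1))ᶜ
      ≤ P.real (⋃ r ∈ Finset.Ico t₀ (t + 1), {ω | ε r < b r ω}) := by
        refine measureReal_mono (fun ω hω => ?_) (measure_ne_top _ _)
        rw [Set.mem_compl_iff, biasLe, Set.mem_ofPred_eq] at hω
        push Not at hω
        obtain ⟨r, h1, h2, h3⟩ := hω
        exact Set.mem_biUnion (Finset.mem_coe.2 (Finset.mem_Ico.2 ⟨h1, h2⟩)) h3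
    _ ≤ ∑ r ∈ Finset.Ico t₀ (t + 1), P.real {ω | ε r < b r ω} := measureReal_biUnion_finset_le _ _
    _ ≤ ∑ r ∈ Finset.Ico t₀ (t + 1), 1 / (r : ℝ) ^ 3 :=
        Finset.sum_le_sum fun r hr =>
          hb r (Finset.mem_Ico.1 hr).1 (Nat.lt_succ_iff.1 (Finset.mem_Ico.1 hr).2)
    _ ≤ _ := (sum_Ico_inv_cube_le ht₀ ht).trans (by
        have : (0 : ℝ) ≤ 1 / (2 * (((t + 1 : ℕ) : ℝ) - 1) * (t + 1 : ℕ)) := by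
          push_cast
          rw [add_sub_cancel_right]
          positivity
        linarith)

/-- The tail bound behind the in-probability rate, for one large time `t` and starting time
`t₀` of order `√t`. -/
theorem measureReal_bias_and_abs_e [IsProbabilityMeasure P]
    (h : IsContractingScheme P m e u ξ b κ c β M) {C₁ ℓ : ℝ} (hC₁ : 0 ≤ C₁) (hℓ : 0 ≤ ℓ)
    {t₀ t : ℕ} (ht₀ : 1 ≤ t₀) (ht : t₀ ≤ t)
    (hγ : ∀ r, t₀ ≤ r → c * (r : ℝ) ^ (-β) ≤ 1)
    (hpow : ∀ r : ℕ, t₀ ≤ r → ∀ p ∈ Set.Icc (0 : ℝ) 1,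
      (1 - κ * c / 2 * (r : ℝ) ^ (-β)) * (r : ℝ) ^ (-p) ≤ ((r + 1 : ℕ) : ℝ) ^ (-p))
    {l y : ℝ} (hl : 0 ≤ l) (hy : 0 ≤ y) :
    P.real (biasLe b (fun r => C₁ * ℓ * (r : ℝ) ^ (-(1 / 2) : ℝ)) t₀ t ∩
      {ω | 2 * C₁ / κ * ℓ * (t : ℝ) ^ (-(1 / 2) : ℝ) + M * t₀ * (t : ℝ) ^ (-(1 : ℝ)) + y ≤
        |e t ω|}) ≤ 2 * Real.exp (l ^ 2 * (2 * c / κ * (t : ℝ) ^ (-β)) - l * y) := by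
  have hκ := h.κ_pos
  have hc := h.c_pos
  have hM := h.M_nonneg
  -- Both sequences solve their recursions by spending half of the contraction. The first term of
  -- `L` follows the bias. The second forgets the initial bound `M` at speed `t₀ / r`, the fastest
  -- power that `hpow` allows.
  have h1 := h.setIntegral_cosh_le ht₀ hγ (ε := fun r => C₁ * ℓ * (r : ℝ) ^ (-(1 / 2) : ℝ))
    (A := fun r => 2 * c / κ * (r : ℝ) ^ (-β))
    (L := fun r => 2 * C₁ / κ * ℓ * (r : ℝ) ^ (-(1 / 2) : ℝ) + M * t₀ * (r : ℝ) ^ (-(1 : ℝ)))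
    (fun r => by positivity) (by positivity) ?_ (fun r hr => ?_) (fun r _ => by positivity)
    (fun r hr => ?_) ht hl
  · refine (h.measureReal_inter_abs_e_ge_le (ht₀.trans ht) (by positivity) h1).trans_eq ?_
    congr 2
    ring
  · have hpos : (0 : ℝ) < t₀ := by exact_mod_cast ht₀
    have h2 : M * t₀ * (t₀ : ℝ) ^ (-(1 : ℝ)) = M := by
      rw [Real.rpow_neg_one]
      field_simp
    rw [h2]
    have : 0 ≤ 2 * C₁ / κ * ℓ * (t₀ : ℝ) ^ (-(1 / 2) : ℝ) := by positivity
    linarith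
  · have h2 := mul_le_mul_of_nonneg_left (hpow r hr β ⟨h.β_mem.1.le, h.β_mem.2.le⟩)
      (by positivity : 0 ≤ 2 * c / κ)
    refine le_trans (le_of_eq ?_) h2
    field_simp
    ring
  · have h2 := mul_le_mul_of_nonneg_left (hpow r hr (1 / 2) ⟨by norm_num, by norm_num⟩)
      (by positivity : 0 ≤ 2 * C₁ / κ * ℓ)
    have h3 := mul_le_mul_of_nonneg_left (hpow r hr 1 ⟨by norm_num, by norm_num⟩)
      (by positivity : 0 ≤ M * (t₀ : ℝ))
    have h4 : 0 ≤ κ * c / 2 * (r : ℝ) ^ (-β) * (M * t₀ * (r : ℝ) ^ (-(1 : ℝ))) := by positivity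
    refine le_trans (le_of_eq ?_) (add_le_add h2 (h3.trans' (by linarith :
      (1 - κ * c * (r : ℝ) ^ (-β)) * (M * t₀ * (r : ℝ) ^ (-(1 : ℝ))) ≤ _)))
    field_simp
    ring

theorem exists_rate_in_probability [IsProbabilityMeasure P]
    (h : IsContractingScheme P m e u ξ b κ c β M) {C₁ : ℝ} (hC₁ : 0 < C₁)
    (hb : ∀ᶠ t : ℕ in atTop,
      P.real {ω | C₁ * Real.log t ^ (3 / 2 : ℝ) * (t : ℝ) ^ (-(1 / 2) : ℝ) ≤ b t ω} ≤
        1 / (t : ℝ) ^ 3) :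
    ∃ T₀ : ℕ, 1 ≤ T₀ ∧ ∃ C₀ : ℝ, 0 < C₀ ∧ ∀ t : ℕ, T₀ ≤ t → 1 - 1 / (t : ℝ) ≤
      P.real {ω | |e t ω| + b t ω ≤ C₀ * (Real.log t ^ (1 / 2 : ℝ) * (t : ℝ) ^ (-(β / 2)) +
        Real.log t ^ (3 / 2 : ℝ) * (t : ℝ) ^ (-(1 / 2) : ℝ))} := by
  have hκ := h.κ_pos
  have hc := h.c_pos
  have hM := h.M_nonneg
  obtain ⟨s, hs⟩ := eventually_atTop.1 ((eventually_rpow_mul_le h.β_mem.2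
    (by positivity : 0 < κ * c / 2)).and (hb.and h.eventually_step_le))
  -- `T₀` forces `√t ≥ s + 4`, so every asymptotic bound holds from `t₀` on and `t ≥ 16`. In `C₀`
  -- the summands account for the drift of the bias, the initial error, the bias at time `t`, and
  -- the deviation `y`.
  refine ⟨(s + 4) ^ 2, Nat.one_le_pow _ _ (by omega), 2 * C₁ / κ + 3 * M + C₁ + (2 * c / κ + 2), by positivity,
    fun t ht => ?_⟩
  have hsq : s + 4 ≤ Nat.sqrt t := Nat.le_sqrt'.2 ht
  -- With this start `(t₀ - 1) t₀ ≥ t`, so the union bound over the bias costs at most `1/(2t)`,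
  -- while the initial error `M t₀ / t` is still of order `t^{-1/2}`.
  set t₀ := Nat.sqrt t + 2 with ht₀
  have hst₀ : s ≤ t₀ := by omega
  have hsqt : Nat.sqrt t * Nat.sqrt t ≤ t := Nat.sqrt_le t
  have hsqt' : t < (Nat.sqrt t + 1) * (Nat.sqrt t + 1) := Nat.lt_succ_sqrt t
  have ht₀t : t₀ ≤ t := by nlinarith
  have ht16 : 16 ≤ t := by nlinarith
  have htR : (16 : ℝ) ≤ t := by exact_mod_cast ht16
  have htpos : (0 : ℝ) < t := by linarith
  have hlog : 1 ≤ Real.log t := by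
    rw [Real.le_log_iff_exp_le htpos]
    linarith [Real.exp_one_lt_d9]
  have hlog0 : 0 ≤ Real.log t := by linarith
  set ℓ := Real.log t ^ (3 / 2 : ℝ) with hℓ
  have hℓ1 : 1 ≤ ℓ := Real.one_le_rpow hlog (by norm_num)
  -- The Chernoff parameters are tuned so that the variance term is `(2c/κ) log t` and `l y` is
  -- `(2c/κ + 2) log t`, leaving a tail of `2 t⁻²`.
  set y := (2 * c / κ + 2) * (Real.log t ^ (1 / 2 : ℝ) * (t : ℝ) ^ (-(β / 2))) with hy
  set l := Real.log t ^ (1 / 2 : ℝ) * (t : ℝ) ^ (β / 2) with hl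
  have hlog2 : Real.log t ^ (1 / 2 : ℝ) * Real.log t ^ (1 / 2 : ℝ) = Real.log t := by
    rw [← Real.rpow_add (by linarith)]
    norm_num
  have ht2 : (t : ℝ) ^ (β / 2) * (t : ℝ) ^ (-(β / 2)) = 1 := by
    rw [← Real.rpow_add htpos]
    simp
  have ht3 : (t : ℝ) ^ (β / 2) * (t : ℝ) ^ (β / 2) * (t : ℝ) ^ (-β) = 1 := by
    rw [← Real.rpow_add htpos, ← Real.rpow_add htpos]
    simp
  have hexp : l ^ 2 * (2 * c / κ * (t : ℝ) ^ (-β)) - l * y = -(2 * Real.log t) := by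
    have h1 : l ^ 2 * (2 * c / κ * (t : ℝ) ^ (-β)) = 2 * c / κ *
        (Real.log t ^ (1 / 2 : ℝ) * Real.log t ^ (1 / 2 : ℝ)) *
        ((t : ℝ) ^ (β / 2) * (t : ℝ) ^ (β / 2) * (t : ℝ) ^ (-β)) := by
      rw [hl]
      ring
    have h2 : l * y = (2 * c / κ + 2) *
        (Real.log t ^ (1 / 2 : ℝ) * Real.log t ^ (1 / 2 : ℝ)) *
        ((t : ℝ) ^ (β / 2) * (t : ℝ) ^ (-(β / 2))) := by
      rw [hl, hy]
      ring
    rw [h1, h2, hlog2, ht2, ht3]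
    ring
  have htail := h.measureReal_bias_and_abs_e hC₁.le (by linarith : 0 ≤ ℓ) (by omega) ht₀t
    (fun r hr => (hs r (hst₀.trans hr)).2.2) (fun r hr => (hs r (hst₀.trans hr)).1)
    (by positivity : 0 ≤ l) (by positivity : 0 ≤ y)
  rw [hexp, Real.exp_neg, mul_comm 2 (Real.log t), Real.exp_mul, Real.exp_log htpos] at htail
  -- The bias threshold carries `log t` instead of `log r`, which makes it a pure power of `r`. It
  -- is only larger, since `r ≤ t`.
  have hbias := measureReal_compl_biasLe_le (P := P) (b := b)
    (ε := fun r => C₁ * ℓ * (r : ℝ) ^ (-(1 / 2) : ℝ)) (by omega : 2 ≤ t₀) (by omega : t₀ ≤ t + 1)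
    fun r hr hrt => (measureReal_mono fun ω hω => by
      rw [Set.mem_ofPred_eq] at hω ⊢
      refine le_trans ?_ hω.le
      have hr1 : (1 : ℝ) ≤ r := by exact_mod_cast (by omega : 1 ≤ r)
      have : Real.log r ≤ Real.log t :=
        Real.log_le_log (by linarith) (by exact_mod_cast hrt)
      have h0 := Real.log_nonneg hr1
      rw [hℓ]
      gcongr).trans (hs r (hst₀.trans hr)).2.1
  set S₁ := biasLe b (fun r => C₁ * ℓ * (r : ℝ) ^ (-(1 / 2) : ℝ)) t₀ (t + 1)
  set S₂ := biasLe b (fun r => C₁ * ℓ * (r : ℝ) ^ (-(1 / 2) : ℝ)) t₀ t ∩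
    {ω | 2 * C₁ / κ * ℓ * (t : ℝ) ^ (-(1 / 2) : ℝ) + M * t₀ * (t : ℝ) ^ (-(1 : ℝ)) + y ≤ |e t ω|}
  have hsum : P.real (S₁ᶜ ∪ S₂) ≤ 1 / t := by
    refine (measureReal_union_le _ _).trans ?_
    have h1 : 1 / (2 * ((t₀ : ℝ) - 1) * t₀) ≤ 1 / (2 * t) := by
      apply one_div_le_one_div_of_le (by positivity)
      have : (t : ℝ) < (Nat.sqrt t + 1) * (Nat.sqrt t + 1) := by exact_mod_cast hsqt'
      rw [ht₀]
      push_cast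
      nlinarith
    have h2 : 2 * ((t : ℝ) ^ (2 : ℝ))⁻¹ ≤ 1 / (2 * t) := by
      rw [Real.rpow_two]
      field_simp
      linarith
    have h3 : 1 / (t : ℝ) = 1 / (2 * t) + 1 / (2 * t) := by
      field_simp
      norm_num
    linarith
  set G := {ω | |e t ω| + b t ω ≤ (2 * C₁ / κ + 3 * M + C₁ + (2 * c / κ + 2)) *
    (Real.log t ^ (1 / 2 : ℝ) * (t : ℝ) ^ (-(β / 2)) + ℓ * (t : ℝ) ^ (-(1 / 2) : ℝ))}
  have hG : Gᶜ ⊆ S₁ᶜ ∪ S₂ := by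
    intro ω hω
    by_contra hcon
    rw [Set.mem_union, not_or, Set.mem_compl_iff, not_not] at hcon
    obtain ⟨hω1, hω2⟩ := hcon
    apply hω
    have hbt : b t ω ≤ C₁ * ℓ * (t : ℝ) ^ (-(1 / 2) : ℝ) := hω1 t ht₀t t.lt_succ_self
    have het : |e t ω| < 2 * C₁ / κ * ℓ * (t : ℝ) ^ (-(1 / 2) : ℝ) +
        M * t₀ * (t : ℝ) ^ (-(1 : ℝ)) + y := by
      by_contra hcon
      exact hω2 ⟨fun r h1 h2 => hω1 r h1 (h2.trans t.lt_succ_self), not_lt.1 hcon⟩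
    have hz : M * t₀ * (t : ℝ) ^ (-(1 : ℝ)) ≤ 3 * M * ℓ * (t : ℝ) ^ (-(1 / 2) : ℝ) := by
      have h1 : (t₀ : ℝ) ≤ 3 * (t : ℝ) ^ (1 / 2 : ℝ) := by
        rw [← Real.sqrt_eq_rpow, ht₀]
        push_cast
        have h2 : (Nat.sqrt t : ℝ) ≤ √t := Real.nat_sqrt_le_real_sqrt
        have h3 : (4 : ℝ) ≤ (Nat.sqrt t : ℝ) := by exact_mod_cast (by omega : 4 ≤ Nat.sqrt t)
        linarith
      have h4 : (t : ℝ) ^ (1 / 2 : ℝ) * (t : ℝ) ^ (-(1 : ℝ)) = (t : ℝ) ^ (-(1 / 2) : ℝ) := by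
        rw [← Real.rpow_add htpos]
        norm_num
      calc M * t₀ * (t : ℝ) ^ (-(1 : ℝ))
          ≤ M * (3 * (t : ℝ) ^ (1 / 2 : ℝ)) * (t : ℝ) ^ (-(1 : ℝ)) := by gcongr
        _ = 3 * M * 1 * (t : ℝ) ^ (-(1 / 2) : ℝ) := by rw [← h4]; ring
        _ ≤ _ := by gcongr
    change |e t ω| + b t ω ≤ _
    have hu : 0 ≤ Real.log t ^ (1 / 2 : ℝ) * (t : ℝ) ^ (-(β / 2)) := by positivity
    have hw : 0 ≤ ℓ * (t : ℝ) ^ (-(1 / 2) : ℝ) := by positivity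
    have hk1 : 0 ≤ 2 * C₁ / κ := by positivity
    have hk2 : 0 ≤ 2 * c / κ := by positivity
    have hx1 := mul_nonneg (by linarith : 0 ≤ 2 * C₁ / κ + 3 * M + C₁) hu
    have hx2 := mul_nonneg (by linarith : 0 ≤ 2 * c / κ + 2) hw
    rw [hy] at het
    linarith
  have hGm : MeasurableSet G := by
    have h1 := (h.measurable_e t (by omega)).mono (h.le t) le_rfl
    have h2 := (h.measurable_b t (by omega)).mono (h.le t) le_rfl
    exact measurableSet_le (by fun_prop) measurable_const
  have := probReal_compl_eq_one_sub (μ := P) hGm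
  have := (measureReal_mono (μ := P) hG).trans hsum
  linarith

end IsContractingScheme

/-! ### The online procedure as a contracting scheme -/

theorem residualRank_lt_one (z : ℝ) : residualRank z < 1 := by
  have := stdNormalCdf_lt_one |z|
  unfold residualRank
  linarith

theorem missProb_of_nonpos {δ q : ℝ} (hq : q ≤ 0) : missProb δ q = 1 := by
  have : NullSingletonClass (gaussianReal 0 1) := nullSingletonClass_gaussianReal one_ne_zero
  have hset : {z | max q 0 < residualRank (z - δ)} = (gaussInterval δ q)ᶜ := by
    ext z
    rw [Set.mem_compl_iff, mem_gaussInterval_iff, not_le, Set.mem_ofPred_eq]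
  rw [missProb, hset, gaussInterval, if_pos hq,
    probReal_compl_eq_one_sub (measurableSet_singleton _), measureReal_def, measure_singleton]
  simp

/-- Coverage error of the interval centered at `x.1.1` with threshold `x.1.2`, for the outcome
`x.2`. -/
def missError (x : (ℝ × ℝ) × ℝ) : ℝ :=
  Set.indicator {x : (ℝ × ℝ) × ℝ | max x.1.2 0 < residualRank (x.2 - x.1.1)} (fun _ => 1) x

theorem missError_of_lt {x : (ℝ × ℝ) × ℝ} (h : max x.1.2 0 < residualRank (x.2 - x.1.1)) :
    missError x = 1 :=
  Set.indicator_of_mem (s := {x : (ℝ × ℝ) × ℝ | max x.1.2 0 < residualRank (x.2 - x.1.1)}) h _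

theorem missError_of_not_lt {x : (ℝ × ℝ) × ℝ} (h : ¬ max x.1.2 0 < residualRank (x.2 - x.1.1)) :
    missError x = 0 :=
  Set.indicator_of_notMem (s := {x : (ℝ × ℝ) × ℝ | max x.1.2 0 < residualRank (x.2 - x.1.1)}) h _

theorem measurable_missError : Measurable missError := by
  have := continuous_residualRank.measurable
  exact measurable_const.indicator (measurableSet_lt (by fun_prop) (by fun_prop))

theorem missError_mem (x : (ℝ × ℝ) × ℝ) : missError x ∈ Set.Icc (0 : ℝ) 1 :=
  ⟨Set.indicator_nonneg (fun _ _ => zero_le_one) x,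
    Set.indicator_le' (fun _ _ => le_rfl) (fun _ _ => zero_le_one) x⟩

theorem integral_missError (w : ℝ × ℝ) :
    ∫ v, missError (w, v) ∂(gaussianReal 0 1) = missProb w.1 w.2 := by
  have hm : MeasurableSet {v | max w.2 0 < residualRank (v - w.1)} := by
    have := continuous_residualRank.measurable
    exact measurableSet_lt measurable_const (by fun_prop)
  rw [missProb, ← integral_indicator_one hm]
  rfl

theorem coverageErr_gaussInterval (m q y : ℝ) :
    coverageErr y (gaussInterval m q) = missError ((m, q), y) := by
  unfold coverageErr
  by_cases h : y ∈ gaussInterval m q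
  · have h1 : ¬ max q 0 < residualRank (y - m) := not_lt.2 (mem_gaussInterval_iff.1 h)
    rw [missError_of_not_lt h1, Set.indicator_of_notMem (Set.notMem_compl_iff.2 h)]
  · have h1 : max q 0 < residualRank (y - m) :=
      not_le.1 fun h2 => h (mem_gaussInterval_iff.2 h2)
    rw [Set.indicator_of_mem (Set.mem_compl h), missError_of_lt h1]

/-- Reaction to the coverage error. -/
def missReact (x : (ℝ × ℝ) × ℝ) : ℝ := if x.1.2 < 0 then 1 else missError x

theorem measurable_missReact : Measurable missReact :=
  Measurable.ite (measurableSet_lt (by fun_prop) measurable_const) measurable_const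
    measurable_missError

theorem missReact_mem (x : (ℝ × ℝ) × ℝ) : missReact x ∈ Set.Icc (0 : ℝ) 1 := by
  unfold missReact
  split_ifs
  · exact ⟨zero_le_one, le_rfl⟩
  · exact missError_mem x

theorem integral_missReact (w : ℝ × ℝ) :
    ∫ v, missReact (w, v) ∂(gaussianReal 0 1) = missProb w.1 w.2 := by
  unfold missReact
  by_cases h : w.2 < 0
  -- For a negative threshold the reaction is forced to be `1`, which agrees with the miss
  -- probability of a singleton.
  · simp [h, missProb_of_nonpos h.le]
  · simp only [h, if_false]
    exact integral_missError w

theorem missReact_of_one_le {x : (ℝ × ℝ) × ℝ} (h : 1 ≤ x.1.2) : missReact x = 0 := by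
  have h1 : ¬ max x.1.2 0 < residualRank (x.2 - x.1.1) := by
    have := residualRank_lt_one (x.2 - x.1.1)
    rw [not_lt, le_max_iff]
    left
    linarith
  rw [missReact, if_neg (not_lt.2 (zero_le_one.trans h)), missError_of_not_lt h1]

theorem missProb_mem (δ q : ℝ) : missProb δ q ∈ Set.Icc (0 : ℝ) 1 :=
  ⟨measureReal_nonneg, measureReal_le_one⟩

theorem clampUnit_mem (q : ℝ) : clampUnit q ∈ Set.Icc (0 : ℝ) 1 :=
  ⟨le_max_left _ _, max_le zero_le_one (min_le_right _ _)⟩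

theorem measurable_missProb : Measurable fun w : ℝ × ℝ => missProb w.1 w.2 := by
  simp_rw [← integral_missError]
  exact measurable_missError.stronglyMeasurable.integral_prod_right'.measurable

theorem abs_clampUnit_sub_le {q a : ℝ} (ha : a ∈ Set.Ioo (0 : ℝ) 1) :
    |clampUnit q - a| ≤ |q - a| := by
  unfold clampUnit
  rcases le_total q 0 with h | h
  · rw [min_eq_left (by linarith), max_eq_left h, abs_of_nonpos (by linarith [ha.1]),
      abs_of_nonpos (by linarith [ha.1])]
    linarith
  rcases le_total q 1 with h1 | h1
  · rw [min_eq_left h1, max_eq_right h]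
  · rw [min_eq_right h1, max_eq_right zero_le_one, abs_of_nonneg (by linarith [ha.2]),
      abs_of_nonneg (by linarith [ha.2])]
    linarith

/-- The mean drift of the threshold contracts towards `1 - α` on bounded sets. -/
theorem abs_add_drift_le {α c q γ : ℝ} (hα : α ∈ Set.Ioo (0 : ℝ) 1) (hc : 0 < c)
    (hγ0 : 0 ≤ γ) (hγ1 : γ ≤ 1) (hq : |q - (1 - α)| ≤ 1 + c) :
    |q - (1 - α) + γ * (1 - clampUnit q - α)| ≤
      (1 - min α (1 - α) / (1 + c) * γ) * |q - (1 - α)| := by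
  set κ := min α (1 - α) / (1 + c) with hκ
  have h1c : 0 < 1 + c := by linarith
  have hκ0 : 0 ≤ κ := div_nonneg (le_min hα.1.le (by linarith [hα.2])) h1c.le
  have hκe : κ * |q - (1 - α)| ≤ min α (1 - α) := by
    calc κ * |q - (1 - α)| ≤ κ * (1 + c) := mul_le_mul_of_nonneg_left hq hκ0
      _ = min α (1 - α) := div_mul_cancel₀ _ h1c.ne'
  have hκ1 : κ ≤ 1 := by
    rw [hκ, div_le_one h1c]
    exact (min_le_left _ _).trans (by linarith [hα.2])
  unfold clampUnit
  -- Inside `[0, 1]` the drift is `-γ (q - (1 - α))`. Outside it has constant size, `γ (1 - α)`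
  -- upward or `γ α` downward, which is at least `κ γ |q - (1 - α)|` by the choice of `κ`; `γ ≤ 1`
  -- prevents overshooting.
  rcases le_total q 0 with h | h
  · have h2 := hκe.trans (min_le_right _ _)
    rw [abs_of_nonpos (by linarith [hα.2] : q - (1 - α) ≤ 0)] at h2 ⊢
    rw [min_eq_left (by linarith), max_eq_left h, abs_of_nonpos (by nlinarith [hα.2])]
    nlinarith
  rcases le_total q 1 with h1 | h1
  · rw [min_eq_left h1, max_eq_right h,
      show q - (1 - α) + γ * (1 - q - α) = (1 - γ) * (q - (1 - α)) by ring, abs_mul,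
      abs_of_nonneg (by linarith : 0 ≤ 1 - γ)]
    refine mul_le_mul_of_nonneg_right ?_ (abs_nonneg _)
    nlinarith
  · have h2 := hκe.trans (min_le_left _ _)
    rw [abs_of_nonneg (by linarith [hα.1] : 0 ≤ q - (1 - α))] at h2 ⊢
    rw [min_eq_right h1, max_eq_right zero_le_one, abs_of_nonneg (by nlinarith [hα.1])]
    nlinarith

/-! ### Threshold recursion and measurability in the autoregressive model -/

section ARProcedure

variable {Ω : Type*} {d : ℕ} (φ : EuclideanSpace ℝ (Fin d)) (Y : ℤ → Ω → ℝ)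
  (φhat : ℕ → Ω → EuclideanSpace ℝ (Fin d))

/-- Prediction error of the estimator at time `t`. -/
def predError (t : ℕ) (ω : Ω) : ℝ :=
  inner ℝ (φhat t ω) (arCovariate d Y t ω) - inner ℝ φ (arCovariate d Y t ω)

theorem inner_arCovariate (ψ : EuclideanSpace ℝ (Fin d)) (t : ℕ) (ω : Ω) :
    inner ℝ ψ (arCovariate d Y t ω) = ∑ k : Fin d, ψ k * Y ((t : ℤ) - ((k : ℕ) + 1)) ω := by
  simp [arCovariate, PiLp.inner_apply, mul_comm]

theorem selectionNumber_noSelection {𝒳 𝒴 : Type*} (err : ℕ → 𝒴 → Set 𝒴 → ℝ) (γ : ℕ → ℝ)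
    (α q₁ : ℝ) (C : ℕ → 𝒳 → ℝ → Set 𝒴) (x : ℕ → 𝒳) (y : ℕ → 𝒴) {t : ℕ} (ht : 1 ≤ t) :
    selectionNumber err γ α q₁ noSelection C x y t = t := by
  obtain ⟨k, rfl⟩ : ∃ k, t = k + 1 := ⟨t - 1, by omega⟩
  rw [selectionNumber_eq]
  simp [noSelection]

theorem missError_sub (m δ q y : ℝ) : missError ((m + δ, q), m + y) = missError ((δ, q), y) := by
  simp only [missError, Set.indicator_apply, Set.mem_ofPred_eq, add_sub_add_left_eq_sub]

/-- Subtracting `⟨φ, X_t⟩` from both outcome and center does not change the miss event. This holds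
for every vector `φ`; the value `0` serves for pathwise facts, the true one for probabilities. -/
theorem coverageErr_arInterval (t : ℕ) (q : ℝ) (ω : Ω) :
    coverageErr (Y t ω) (arInterval φhat ω t (arCovariate d Y t ω) q) =
      missError ((predError φ Y φhat t ω, q), IsStationaryAR.innovation φ Y t ω) := by
  rw [arInterval, coverageErr_gaussInterval, ← missError_sub (inner ℝ φ (arCovariate d Y t ω))
    (predError φ Y φhat t ω)]
  rw [show inner ℝ φ (arCovariate d Y t ω) + predError φ Y φhat t ω =
      inner ℝ (φhat t ω) (arCovariate d Y t ω) by rw [predError]; ring,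
    show inner ℝ φ (arCovariate d Y t ω) + IsStationaryAR.innovation φ Y t ω = Y t ω by
      rw [IsStationaryAR.innovation, inner_arCovariate]; ring]

theorem arThreshold_succ (α c β q₁ : ℝ) {t : ℕ} (ht : 1 ≤ t) (ω : Ω) :
    arThreshold Y φhat α c β q₁ (t + 1) ω = arThreshold Y φhat α c β q₁ t ω +
      c * (t : ℝ) ^ (-β) * (missReact ((predError φ Y φhat t ω, arThreshold Y φhat α c β q₁ t ω),
        IsStationaryAR.innovation φ Y t ω) - α) := by
  have h := threshold_succ (fun _ => coverageErr) (fun j : ℕ => c * (j : ℝ) ^ (-β)) α q₁ noSelection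
    (arInterval φhat ω) (fun k => arCovariate d Y k ω) (fun k => Y (k : ℤ) ω) t ht
  rw [selectionNumber_noSelection _ _ _ _ _ _ _ ht] at h
  change arThreshold Y φhat α c β q₁ (t + 1) ω = arThreshold Y φhat α c β q₁ t ω +
    c * (t : ℝ) ^ (-β) * (react coverageErr (Y t ω) (arInterval φhat ω t (arCovariate d Y t ω)
      (arThreshold Y φhat α c β q₁ t ω)) (arThreshold Y φhat α c β q₁ t ω) - α) * ((1 : ℕ) : ℝ) at h
  rw [h, react, coverageErr_arInterval φ]
  unfold missReact
  by_cases hq : arThreshold Y φhat α c β q₁ t ω < 0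
  · simp [hq, not_le.2 hq]
  · simp [hq, not_lt.1 hq]

/-- Below `0` the reaction is `1` and the threshold increases; from `1` on everything is covered and
it decreases. No step exceeds `c`, so it overshoots `[0, 1]` by at most `c`. -/
theorem arThreshold_mem {α c β q₁ : ℝ} (hα : α ∈ Set.Ioo (0 : ℝ) 1) (hc : 0 < c) (hβ : 0 < β)
    (hq₁ : q₁ ∈ Set.Icc (0 : ℝ) 1) {t : ℕ} (ht : 1 ≤ t) (ω : Ω) :
    arThreshold Y φhat α c β q₁ t ω ∈ Set.Icc (-c) (1 + c) := by
  induction t, ht using Nat.le_induction with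
  | base =>
    change q₁ ∈ _
    exact ⟨by linarith [hq₁.1], by linarith [hq₁.2]⟩
  | succ t ht ih =>
    rw [arThreshold_succ 0 Y φhat α c β q₁ ht]
    set q := arThreshold Y φhat α c β q₁ t ω
    set x := ((predError 0 Y φhat t ω, q), IsStationaryAR.innovation (0 : EuclideanSpace ℝ (Fin d)) Y t ω)
    have hγ0 : 0 ≤ c * (t : ℝ) ^ (-β) := by positivity
    have hγ1 : c * (t : ℝ) ^ (-β) ≤ c := by
      have : (t : ℝ) ^ (-β) ≤ 1 :=
        Real.rpow_le_one_of_one_le_of_nonpos (by exact_mod_cast ht) (by linarith)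
      nlinarith
    set γ := c * (t : ℝ) ^ (-β)
    have hx := missReact_mem x
    constructor
    · by_cases hq : q < 0
      · have h1 : missReact x = 1 := if_pos hq
        rw [h1]
        nlinarith [ih.1, hα.2]
      · nlinarith [hx.1, hα.2]
    · by_cases hq : 1 ≤ q
      · rw [missReact_of_one_le (x := x) hq]
        nlinarith [ih.2, hα.1]
      · nlinarith [hx.2, hα.1]

variable {Y φhat}

theorem arFiltration_le [m0 : MeasurableSpace Ω] (hY : ∀ t, Measurable (Y t)) (n : ℕ) (t : ℤ) :
    arFiltration Y n t ≤ m0 :=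
  iSup₂_le fun s _ => (hY s).comap_le

theorem arFiltration_mono (n : ℕ) : Monotone (arFiltration Y n) := fun _ _ h =>
  biSup_mono fun _ hs => ⟨hs.1, hs.2.trans h⟩

theorem measurable_arFiltration {n : ℕ} {s t : ℤ} (hs : s ∈ Set.Icc (-((n : ℤ) - 1)) t) :
    Measurable[arFiltration Y n t] (Y s) :=
  (comap_measurable _).mono
    (le_iSup₂_of_le (f := fun s (_ : s ∈ Set.Icc (-((n : ℤ) - 1)) t) =>
      MeasurableSpace.comap (Y s) inferInstance) s hs le_rfl) le_rfl

theorem measurable_covariate_arFiltration {n : ℕ} (hn : d ≤ n) {t : ℕ} (ht : 1 ≤ t) (k : Fin d) :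
    Measurable[arFiltration Y n ((t : ℤ) - 1)] (Y ((t : ℤ) - ((k : ℕ) + 1))) := by
  have := k.2
  -- The oldest index is `t - d ≥ 1 - d ≥ -(n - 1)`: here `d ≤ n` places the covariate in the
  -- observed window.
  exact measurable_arFiltration ⟨by omega, by omega⟩

theorem measurable_predError {n : ℕ} (hn : d ≤ n) {t : ℕ} (ht : 1 ≤ t)
    (hφhat : Measurable[arFiltration Y n ((t : ℤ) - 1)] (φhat t)) :
    Measurable[arFiltration Y n ((t : ℤ) - 1)] (predError φ Y φhat t) := by
  have h1 : predError φ Y φhat t = fun ω =>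
      ∑ k : Fin d, (φhat t ω k - φ k) * Y ((t : ℤ) - ((k : ℕ) + 1)) ω := by
    ext ω
    rw [predError, inner_arCovariate, inner_arCovariate, ← Finset.sum_sub_distrib]
    exact Finset.sum_congr rfl fun k _ => (sub_mul _ _ _).symm
  rw [h1]
  refine Finset.measurable_sum _ fun k _ => ?_
  have hk : Measurable fun x : EuclideanSpace ℝ (Fin d) => x k := by fun_prop
  exact ((hk.comp hφhat).sub_const (φ k)).mul (measurable_covariate_arFiltration hn ht k)

theorem measurable_innovation_arFiltration {n : ℕ} (hn : d ≤ n) {t : ℕ} (ht : 1 ≤ t) :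
    Measurable[arFiltration Y n t] (IsStationaryAR.innovation φ Y t) := by
  refine Measurable.sub (measurable_arFiltration ⟨by omega, le_rfl⟩) ?_
  refine Finset.measurable_sum _ fun k _ => ?_
  exact ((measurable_covariate_arFiltration hn ht k).mono
    (arFiltration_mono n (by omega)) le_rfl).const_mul (φ k)

theorem measurable_arThreshold {n : ℕ} (hn : d ≤ n)
    (hφhat : ∀ t : ℕ, 1 ≤ t → Measurable[arFiltration Y n ((t : ℤ) - 1)] (φhat t))
    (α c β q₁ : ℝ) {t : ℕ} (ht : 1 ≤ t) :
    Measurable[arFiltration Y n ((t : ℤ) - 1)] (arThreshold Y φhat α c β q₁ t) := by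
  induction t, ht using Nat.le_induction with
  | base => exact measurable_const
  | succ t ht ih =>
    have h1 : arThreshold Y φhat α c β q₁ (t + 1) = fun ω => arThreshold Y φhat α c β q₁ t ω +
        c * (t : ℝ) ^ (-β) * (missReact ((predError 0 Y φhat t ω, arThreshold Y φhat α c β q₁ t ω),
          IsStationaryAR.innovation (0 : EuclideanSpace ℝ (Fin d)) Y t ω) - α) := by
      ext ω
      exact arThreshold_succ 0 Y φhat α c β q₁ ht ω
    have hle := arFiltration_mono (Y := Y) n (show (t : ℤ) - 1 ≤ t by omega)
    have h2 := (measurable_predError 0 hn ht (hφhat t ht)).mono hle le_rfl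
    have h3 := ih.mono hle le_rfl
    have h4 := measurable_innovation_arFiltration (Y := Y) (0 : EuclideanSpace ℝ (Fin d)) hn ht
    rw [h1, show (((t + 1 : ℕ) : ℤ) - 1) = t by push_cast; ring]
    exact h3.add (((measurable_missReact.comp ((h2.prodMk h3).prodMk h4)).sub_const α).const_mul _)

end ARProcedure

/-- The exponent `β/2` beats both regimes: `β/2 ≥ β/3`, and `β/2 ≥ β - 1/2` as `β ≤ 1`. -/
theorem sqrt_log_mul_rpow_le_rate {β : ℝ} (hβ : 1 / 2 < β) (hβ1 : β < 1) {t : ℕ} (ht : 1 ≤ t) :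
    Real.log t ^ (1 / 2 : ℝ) * (t : ℝ) ^ (-(β / 2)) ≤ rate (1 / 2) β t := by
  have ht1 : (1 : ℝ) ≤ t := by exact_mod_cast ht
  have h0 : 0 ≤ Real.log t ^ (1 / 2 : ℝ) := Real.rpow_nonneg (Real.log_nonneg ht1) _
  unfold rate
  split_ifs with h
  · exact mul_le_mul_of_nonneg_left
      (Real.rpow_le_rpow_of_exponent_le ht1 (by linarith)) h0
  · have h1 : 0 ≤ (t : ℝ) ^ (β - 1) := by positivity
    have h2 := mul_le_mul_of_nonneg_left
      (Real.rpow_le_rpow_of_exponent_le ht1 (by linarith : -(β / 2) ≤ 1 / 2 - β)) h0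
    linarith

/-! ### Instantaneous error rate, bias and the contracting scheme -/

section ARProcedure

variable {Ω : Type*} {d : ℕ} {φ : EuclideanSpace ℝ (Fin d)} {Y Z : ℤ → Ω → ℝ} {n : ℕ}
  {φhat : ℕ → Ω → EuclideanSpace ℝ (Fin d)} {α c β q₁ : ℝ}

/-- Instantaneous miscoverage probability of the procedure, as an explicit function of the
prediction error and the threshold. -/
def arMissProb (φ : EuclideanSpace ℝ (Fin d)) (Y : ℤ → Ω → ℝ)
    (φhat : ℕ → Ω → EuclideanSpace ℝ (Fin d)) (α c β q₁ : ℝ) (t : ℕ) (ω : Ω) : ℝ :=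
  missProb (predError φ Y φhat t ω) (arThreshold Y φhat α c β q₁ t ω)

/-- Deviation of the miscoverage probability from its value for the true coefficients. -/
def arBias (φ : EuclideanSpace ℝ (Fin d)) (Y : ℤ → Ω → ℝ)
    (φhat : ℕ → Ω → EuclideanSpace ℝ (Fin d)) (α c β q₁ : ℝ) (t : ℕ) (ω : Ω) : ℝ :=
  |arMissProb φ Y φhat α c β q₁ t ω - (1 - clampUnit (arThreshold Y φhat α c β q₁ t ω))|

theorem arBias_le (t : ℕ) (ω : Ω) :
    arBias φ Y φhat α c β q₁ t ω ≤ |predError φ Y φhat t ω| :=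
  abs_missProb_sub_le _ _

theorem abs_arMissProb_sub_le (hα : α ∈ Set.Ioo (0 : ℝ) 1) (t : ℕ) (ω : Ω) :
    |arMissProb φ Y φhat α c β q₁ t ω - α| ≤
      |arThreshold Y φhat α c β q₁ t ω - (1 - α)| + arBias φ Y φhat α c β q₁ t ω := by
  have h1 := abs_clampUnit_sub_le (q := arThreshold Y φhat α c β q₁ t ω) (a := 1 - α)
    ⟨by linarith [hα.2], by linarith [hα.1]⟩
  have h2 : arMissProb φ Y φhat α c β q₁ t ω - α =
      (arMissProb φ Y φhat α c β q₁ t ω - (1 - clampUnit (arThreshold Y φhat α c β q₁ t ω))) -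
      (clampUnit (arThreshold Y φhat α c β q₁ t ω) - (1 - α)) := by ring
  rw [h2]
  refine (abs_sub _ _).trans ?_
  rw [add_comm]
  exact add_le_add_left h1 _

variable [MeasurableSpace Ω] {P : Measure Ω}

/-- Stated for a general `ψ` because it is used twice: with the coverage error, to identify the
instantaneous error rate, and with the reaction, to center the noise. -/
theorem condExp_eq_arMissProb [IsProbabilityMeasure P] (hAR : IsStationaryAR P φ Y Z) (hn : d ≤ n)
    (hφhat : ∀ t : ℕ, 1 ≤ t → Measurable[arFiltration Y n ((t : ℤ) - 1)] (φhat t))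
    {ψ : (ℝ × ℝ) × ℝ → ℝ} (hψ : Measurable ψ) (hψ1 : ∀ x, ψ x ∈ Set.Icc (0 : ℝ) 1)
    (hint : ∀ w, ∫ v, ψ (w, v) ∂(gaussianReal 0 1) = missProb w.1 w.2) {t : ℕ} (ht : 1 ≤ t) :
    P[fun ω => ψ ((predError φ Y φhat t ω, arThreshold Y φhat α c β q₁ t ω),
        IsStationaryAR.innovation φ Y t ω) | arFiltration Y n ((t : ℤ) - 1)] =ᵐ[P]
      arMissProb φ Y φhat α c β q₁ t := by
  have h := condExp_eq_integral_of_indep (arFiltration_le hAR.measurable n ((t : ℤ) - 1))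
    (hAR.measurable_innovation t) (hAR.indep_arFiltration n t)
    ((measurable_predError φ hn ht (hφhat t ht)).prodMk
      (measurable_arThreshold hn hφhat α c β q₁ ht)) hψ (K := 1)
    (fun x => abs_le.2 ⟨by linarith [(hψ1 x).1], (hψ1 x).2⟩)
  rw [hAR.map_innovation t] at h
  simp only [hint] at h
  exact h

theorem arIER_ae_eq [IsProbabilityMeasure P] (hAR : IsStationaryAR P φ Y Z) (hn : d ≤ n)
    (hφhat : ∀ t : ℕ, 1 ≤ t → Measurable[arFiltration Y n ((t : ℤ) - 1)] (φhat t))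
    {t : ℕ} (ht : 1 ≤ t) :
    arIER P Y n φhat α c β q₁ t =ᵐ[P] arMissProb φ Y φhat α c β q₁ t := by
  have h := condExp_eq_arMissProb (α := α) (c := c) (β := β) (q₁ := q₁) hAR hn hφhat
    measurable_missError missError_mem integral_missError ht
  filter_upwards [h] with ω hω
  rw [← hω]
  simp only [arIER, instErrorRate, noSelection, Bool.toNat_true, Nat.cast_one, mul_one,
    coverageErr_arInterval φ]
  rw [condExp_const (arFiltration_le hAR.measurable n ((t : ℤ) - 1)), div_one]

/-- The threshold of the procedure is a contracting stochastic approximation of `1 - α`. -/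
theorem isContractingScheme [IsProbabilityMeasure P] (hAR : IsStationaryAR P φ Y Z) (hn : d ≤ n)
    (hφhat : ∀ t : ℕ, 1 ≤ t → Measurable[arFiltration Y n ((t : ℤ) - 1)] (φhat t))
    (hα : α ∈ Set.Ioo (0 : ℝ) 1) (hc : 0 < c) (hβ : β ∈ Set.Ioo (0 : ℝ) 1)
    (hq₁ : q₁ ∈ Set.Icc (0 : ℝ) 1) :
    IsContractingScheme P (fun t => arFiltration Y n ((t : ℤ) - 1))
      (fun t ω => arThreshold Y φhat α c β q₁ t ω - (1 - α))
      (fun t ω => arThreshold Y φhat α c β q₁ t ω - (1 - α) +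
        c * (t : ℝ) ^ (-β) * (arMissProb φ Y φhat α c β q₁ t ω - α))
      (fun t ω => missReact ((predError φ Y φhat t ω, arThreshold Y φhat α c β q₁ t ω),
        IsStationaryAR.innovation φ Y t ω) - arMissProb φ Y φhat α c β q₁ t ω)
      (arBias φ Y φhat α c β q₁) (min α (1 - α) / (1 + c)) c β (1 + c) := by
  have hle : ∀ t : ℕ, arFiltration Y n ((t : ℤ) - 1) ≤ ‹MeasurableSpace Ω› := fun t =>
    arFiltration_le hAR.measurable n _
  have hq : ∀ t : ℕ, 1 ≤ t →
      Measurable[arFiltration Y n ((t : ℤ) - 1)] (arThreshold Y φhat α c β q₁ t) := fun t ht =>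
    measurable_arThreshold hn hφhat α c β q₁ ht
  have hδ : ∀ t : ℕ, 1 ≤ t →
      Measurable[arFiltration Y n ((t : ℤ) - 1)] (predError φ Y φhat t) := fun t ht =>
    measurable_predError φ hn ht (hφhat t ht)
  have hp : ∀ t : ℕ, 1 ≤ t →
      Measurable[arFiltration Y n ((t : ℤ) - 1)] (arMissProb φ Y φhat α c β q₁ t) := fun t ht =>
    measurable_missProb.comp ((hδ t ht).prodMk (hq t ht))
  have hcl : Measurable clampUnit := by unfold clampUnit; fun_prop
  have hR : ∀ t : ℕ, 1 ≤ t → Measurable fun ω =>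
      missReact ((predError φ Y φhat t ω, arThreshold Y φhat α c β q₁ t ω),
        IsStationaryAR.innovation φ Y t ω) := fun t ht =>
    measurable_missReact.comp ((((hδ t ht).mono (hle t) le_rfl).prodMk
      ((hq t ht).mono (hle t) le_rfl)).prodMk (hAR.measurable_innovation t))
  have he : ∀ (t : ℕ) (ω : Ω), 1 ≤ t →
      |arThreshold Y φhat α c β q₁ t ω - (1 - α)| ≤ 1 + c := fun t ω ht => by
    have h1 := arThreshold_mem Y φhat hα hc hβ.1 hq₁ ht ω
    rw [abs_le]
    constructor <;> linarith [h1.1, h1.2, hα.1, hα.2]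
  refine
    { le := hle
      mono := fun s t hst => arFiltration_mono n (by omega)
      measurable_e := fun t ht => (hq t ht).sub_const _
      measurable_u := fun t ht =>
        ((hq t ht).sub_const _).add (((hp t ht).sub_const α).const_mul _)
      measurable_b := fun t ht =>
        continuous_abs.measurable.comp ((hp t ht).sub ((hcl.comp (hq t ht)).const_sub 1))
      measurable_ξ := fun t ht => (hR t ht).sub ((hp t ht).mono (hle t) le_rfl)
      condExp_ξ := fun t ht => ?_
      abs_ξ_le := fun t ω ht => ?_
      abs_e_le := fun t ω ht => he t ω ht
      b_nonneg := fun t ω ht => abs_nonneg _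
      b_le := fun t ω ht => ?_
      recursion := fun t ω ht => ?_
      abs_u_le := fun t ω ht hγ => ?_
      κ_pos := div_pos (lt_min hα.1 (by linarith [hα.2])) (by linarith)
      κ_le := ?_
      c_pos := hc
      β_mem := hβ }
  · have h1 := condExp_eq_arMissProb (α := α) (c := c) (β := β) (q₁ := q₁) hAR hn hφhat
      measurable_missReact missReact_mem integral_missReact ht
    have hRi : Integrable (fun ω =>
        missReact ((predError φ Y φhat t ω, arThreshold Y φhat α c β q₁ t ω),
          IsStationaryAR.innovation φ Y t ω)) P :=
      .of_bound (hR t ht).aestronglyMeasurable 1 (ae_of_all _ fun ω => abs_le.2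
        ⟨by linarith [(missReact_mem ((predError φ Y φhat t ω, arThreshold Y φhat α c β q₁ t ω),
          IsStationaryAR.innovation φ Y t ω)).1], (missReact_mem _).2⟩)
    have hpi : Integrable (arMissProb φ Y φhat α c β q₁ t) P :=
      .of_bound ((hp t ht).mono (hle t) le_rfl).aestronglyMeasurable 1 (ae_of_all _ fun ω =>
        abs_le.2 ⟨by linarith [(missProb_mem (predError φ Y φhat t ω)
          (arThreshold Y φhat α c β q₁ t ω)).1, arMissProb.eq_1 φ Y φhat α c β q₁ t ω],
          (missProb_mem _ _).2⟩)
    have h2 := condExp_of_stronglyMeasurable (hle t) (hp t ht).stronglyMeasurable hpi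
    have h3 := condExp_sub hRi hpi (arFiltration Y n ((t : ℤ) - 1))
    filter_upwards [h1, h3] with ω h4 h5
    refine h5.trans ?_
    rw [Pi.sub_apply, h2, h4, sub_self, Pi.zero_apply]
  · have h1 := missReact_mem ((predError φ Y φhat t ω, arThreshold Y φhat α c β q₁ t ω),
      IsStationaryAR.innovation φ Y t ω)
    have h2 := missProb_mem (predError φ Y φhat t ω) (arThreshold Y φhat α c β q₁ t ω)
    rw [arMissProb, abs_le]
    constructor <;> linarith [h1.1, h1.2, h2.1, h2.2]
  · have h1 := clampUnit_mem (arThreshold Y φhat α c β q₁ t ω)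
    have h2 := missProb_mem (predError φ Y φhat t ω) (arThreshold Y φhat α c β q₁ t ω)
    rw [arBias, arMissProb, abs_le]
    constructor <;> linarith [h1.1, h1.2, h2.1, h2.2]
  · rw [arThreshold_succ φ Y φhat α c β q₁ ht]
    ring
  · have hγ0 : 0 ≤ c * (t : ℝ) ^ (-β) := by positivity
    have h1 := abs_add_drift_le hα hc hγ0 hγ (he t ω ht)
    -- The drift is that of perfectly known coefficients plus `γ` times the signed bias.
    have h2 : arThreshold Y φhat α c β q₁ t ω - (1 - α) +
        c * (t : ℝ) ^ (-β) * (arMissProb φ Y φhat α c β q₁ t ω - α) =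
        (arThreshold Y φhat α c β q₁ t ω - (1 - α) +
          c * (t : ℝ) ^ (-β) * (1 - clampUnit (arThreshold Y φhat α c β q₁ t ω) - α)) +
        c * (t : ℝ) ^ (-β) * (arMissProb φ Y φhat α c β q₁ t ω -
          (1 - clampUnit (arThreshold Y φhat α c β q₁ t ω))) := by ring
    rw [h2]
    refine (abs_add_le _ _).trans (add_le_add h1 (le_of_eq ?_))
    rw [abs_mul, abs_of_nonneg hγ0]
    rfl
  · rw [div_le_one (by linarith)]
    exact (min_le_left _ _).trans (by linarith [hα.2])

theorem eventually_measureReal_arBias_le [IsProbabilityMeasure P] (hAR : IsStationaryAR P φ Y Z) (hn : d ≤ n)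
    (hφhat : ∀ t : ℕ, 1 ≤ t → Measurable[arFiltration Y n ((t : ℤ) - 1)] (φhat t))
    (hest : EstimRateInProb P φ Y n φhat (3 / 2) (1 / 2)) :
    ∃ C₁ : ℝ, 0 < C₁ ∧ ∀ᶠ t : ℕ in atTop,
      P.real {ω | C₁ * Real.log t ^ (3 / 2 : ℝ) * (t : ℝ) ^ (-(1 / 2) : ℝ) ≤
        arBias φ Y φhat α c β q₁ t ω} ≤ 1 / (t : ℝ) ^ 3 := by
  obtain ⟨C₁, hC₁, h⟩ := hest
  refine ⟨C₁, hC₁, ?_⟩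
  filter_upwards [h, eventually_ge_atTop 1] with t ht h1
  have hδ := measurable_predError φ hn h1 (hφhat t h1)
  -- The prediction error is known at time `t - 1`, so conditioning does nothing and the hypothesis
  -- bounds the tail of `|δ_t|` itself.
  rw [condLExp_eq_self (arFiltration_le hAR.measurable n _)] at ht
  · have h2 : P.real {ω | C₁ * Real.log t ^ (3 / 2 : ℝ) * (t : ℝ) ^ (-(1 / 2) : ℝ) ≤
        arBias φ Y φhat α c β q₁ t ω} ≤ 3 / (Real.pi ^ 2 * (t : ℝ) ^ 3) := by
      refine ENNReal.toReal_le_of_le_ofReal (by positivity)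
        ((measure_mono fun ω hω => ?_).trans ht)
      exact ENNReal.ofReal_le_ofReal (le_trans hω (arBias_le t ω))
    refine h2.trans ?_
    have hpi : 3 ≤ Real.pi ^ 2 := by nlinarith [Real.pi_gt_three]
    have ht0 : (0 : ℝ) < t := by exact_mod_cast h1
    rw [div_le_div_iff₀ (by positivity) (by positivity), one_mul]
    gcongr
  · exact (continuous_abs.measurable.comp hδ).ennreal_ofReal

theorem eventually_integral_arBias_sq_le (hest : EstimRateInMean P φ Y φhat 0 (1 / 2))
    (hb : ∀ t : ℕ, 1 ≤ t → Measurable (arBias φ Y φhat α c β q₁ t)) :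
    ∃ C₁ : ℝ, 0 < C₁ ∧ ∀ᶠ t : ℕ in atTop,
      ∫ ω, arBias φ Y φhat α c β q₁ t ω ^ 2 ∂P ≤ C₁ * (t : ℝ) ^ (-(1 : ℝ)) := by
  obtain ⟨C₁, hC₁, h⟩ := hest
  refine ⟨C₁, hC₁, ?_⟩
  filter_upwards [h, eventually_ge_atTop 1] with t ht h1
  rw [mul_zero, Real.rpow_zero, mul_one, mul_one_div_cancel two_ne_zero] at ht
  rw [integral_eq_lintegral_of_nonneg_ae (ae_of_all _ fun ω => sq_nonneg _)
    ((hb t h1).pow_const 2).aestronglyMeasurable]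
  refine ENNReal.toReal_le_of_le_ofReal (by positivity)
    ((lintegral_mono fun ω => ENNReal.ofReal_le_ofReal ?_).trans ht)
  rw [← sq_abs (inner ℝ (φhat t ω) (arCovariate d Y t ω) - _)]
  exact pow_le_pow_left₀ (abs_nonneg _) (arBias_le t ω) 2

end ARProcedure

theorem sq_integral_le_integral_sq {Ω : Type*} [MeasurableSpace Ω] {P : Measure Ω}
    [IsProbabilityMeasure P] {f : Ω → ℝ} (hf : MemLp f 2 P) :
    (∫ ω, f ω ∂P) ^ 2 ≤ ∫ ω, f ω ^ 2 ∂P := by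
  have h1 := variance_nonneg f P
  rw [variance_eq_sub hf] at h1
  exact sub_nonneg.1 h1

/-! ### The two convergence rates -/

section ARProcedure

variable {Ω : Type*} [MeasurableSpace Ω] {P : Measure Ω} [IsProbabilityMeasure P] {d : ℕ}
  {φ : EuclideanSpace ℝ (Fin d)} {Y Z : ℤ → Ω → ℝ} {n : ℕ}
  {φhat : ℕ → Ω → EuclideanSpace ℝ (Fin d)} {α c β q₁ : ℝ}

theorem exists_rate_in_probability (hAR : IsStationaryAR P φ Y Z) (hn : d ≤ n)
    (hφhat : ∀ t : ℕ, 1 ≤ t → Measurable[arFiltration Y n ((t : ℤ) - 1)] (φhat t))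
    (hα : α ∈ Set.Ioo (0 : ℝ) 1) (hc : 0 < c) (hβ : β ∈ Set.Ioo (0 : ℝ) 1)
    (hq₁ : q₁ ∈ Set.Icc (0 : ℝ) 1) (hβ2 : 1 / 2 < β)
    (hest : EstimRateInProb P φ Y n φhat (3 / 2) (1 / 2)) :
    ∃ T₀ : ℕ, 1 ≤ T₀ ∧ ∃ C₀ : ℝ, 0 < C₀ ∧ ∀ t : ℕ, T₀ ≤ t →
      1 - 1 / (t : ℝ) ≤ P.real {ω | |arIER P Y n φhat α c β q₁ t ω - α| +
          |arThreshold Y φhat α c β q₁ t ω - (1 - α)| ≤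
        C₀ * (rate (1 / 2) β t + Real.log t ^ (3 / 2 : ℝ) * (t : ℝ) ^ (-(1 / 2) : ℝ))} := by
  obtain ⟨C₁, hC₁, hb⟩ := eventually_measureReal_arBias_le (α := α) (c := c) (β := β) (q₁ := q₁)
    hAR hn hφhat hest
  obtain ⟨T₀, hT₀, C₀, hC₀, h⟩ :=
    (isContractingScheme hAR hn hφhat hα hc hβ hq₁).exists_rate_in_probability hC₁ hb
  -- The factor `2` comes from `|IER_t - α| ≤ |e_t| + b_t`, whence the sum is at most `2 (|e_t| +
  -- b_t)`.
  refine ⟨T₀, hT₀, 2 * C₀, by positivity, fun t ht => (h t ht).trans ?_⟩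
  have ht1 : 1 ≤ t := hT₀.trans ht
  refine ENNReal.toReal_mono (measure_ne_top _ _) (measure_mono_ae ?_)
  filter_upwards [arIER_ae_eq (α := α) (c := c) (β := β) (q₁ := q₁) hAR hn hφhat ht1]
    with ω hω hmem
  change |arIER P Y n φhat α c β q₁ t ω - α| + |arThreshold Y φhat α c β q₁ t ω - (1 - α)| ≤ _
  have h1 : |arThreshold Y φhat α c β q₁ t ω - (1 - α)| + arBias φ Y φhat α c β q₁ t ω ≤ _ := hmem
  have h2 := abs_arMissProb_sub_le (φ := φ) (Y := Y) (φhat := φhat) (c := c) (β := β) (q₁ := q₁)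
    hα t ω
  have h3 := mul_le_mul_of_nonneg_left (sqrt_log_mul_rpow_le_rate hβ2 hβ.2 ht1) hC₀.le
  have h4 : 0 ≤ arBias φ Y φhat α c β q₁ t ω := abs_nonneg _
  rw [hω]
  linarith

theorem exists_rate_in_expectation (hAR : IsStationaryAR P φ Y Z) (hn : d ≤ n)
    (hφhat : ∀ t : ℕ, 1 ≤ t → Measurable[arFiltration Y n ((t : ℤ) - 1)] (φhat t))
    (hα : α ∈ Set.Ioo (0 : ℝ) 1) (hc : 0 < c) (hβ : β ∈ Set.Ioo (0 : ℝ) 1)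
    (hq₁ : q₁ ∈ Set.Icc (0 : ℝ) 1)
    (hest : EstimRateInMean P φ Y φhat 0 (1 / 2)) :
    ∃ T₀ : ℕ, 1 ≤ T₀ ∧ ∃ C₀ : ℝ, 0 < C₀ ∧ ∀ t : ℕ, T₀ ≤ t →
      (∫ ω, |arIER P Y n φhat α c β q₁ t ω - α| *
          Set.indicator (Set.Icc (0 : ℝ) 1) (fun _ => (1 : ℝ))
            (arThreshold Y φhat α c β q₁ t ω) ∂P) ^ 2 +
        ∫ ω, (arThreshold Y φhat α c β q₁ t ω - (1 - α)) ^ 2 ∂P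
      ≤ C₀ * (t : ℝ) ^ (-β + 1 / 2) := by
  have hs := isContractingScheme hAR hn hφhat hα hc hβ hq₁
  have hem := fun t ht => (hs.measurable_e t ht).mono (hs.le t) le_rfl
  have hbm := fun t ht => (hs.measurable_b t ht).mono (hs.le t) le_rfl
  obtain ⟨C₁, hC₁, hb⟩ := eventually_integral_arBias_sq_le hest hbm
  obtain ⟨K, hK, he⟩ := hs.exists_integral_sq_le hb
  obtain ⟨T, hT⟩ := eventually_atTop.1 (hb.and (he.and (eventually_ge_atTop 1)))
  -- The squared mean is at most `2 E e_t² + 2 E b_t²`, and `E e_t²` enters once more. Both `t^{-β}`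
  -- and `t^{-1}` lie below the target power.
  refine ⟨T, (hT T le_rfl).2.2, 3 * K + 2 * C₁, by positivity, fun t ht => ?_⟩
  obtain ⟨h1, h2, ht1⟩ := hT t ht
  have ht1' : (1 : ℝ) ≤ t := by exact_mod_cast ht1
  replace hem := hem t ht1
  replace hbm := hbm t ht1
  have heL : MemLp (fun ω => |arThreshold Y φhat α c β q₁ t ω - (1 - α)|) 2 P :=
    .of_bound (continuous_abs.measurable.comp hem).aestronglyMeasurable (1 + c)
      (ae_of_all _ fun ω => by
        rw [Real.norm_eq_abs, abs_abs]
        exact hs.abs_e_le t ω ht1)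
  have hbL : MemLp (arBias φ Y φhat α c β q₁ t) 2 P :=
    .of_bound hbm.aestronglyMeasurable 1 (ae_of_all _ fun ω => by
      rw [Real.norm_of_nonneg (hs.b_nonneg t ω ht1)]
      exact hs.b_le t ω ht1)
  have hI : ∫ ω, |arIER P Y n φhat α c β q₁ t ω - α| *
      Set.indicator (Set.Icc (0 : ℝ) 1) (fun _ => (1 : ℝ)) (arThreshold Y φhat α c β q₁ t ω) ∂P ≤
      ∫ ω, (|arThreshold Y φhat α c β q₁ t ω - (1 - α)| + arBias φ Y φhat α c β q₁ t ω) ∂P := by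
    refine integral_mono_of_nonneg (ae_of_all _ fun ω => ?_)
      ((heL.add hbL).integrable one_le_two) ?_
    · exact mul_nonneg (abs_nonneg _) (Set.indicator_nonneg (fun _ _ => zero_le_one) _)
    · filter_upwards [arIER_ae_eq (α := α) (c := c) (β := β) (q₁ := q₁) hAR hn hφhat ht1] with ω hω
      rw [hω]
      refine le_trans ?_ (abs_arMissProb_sub_le hα t ω)
      exact mul_le_of_le_one_right (abs_nonneg _)
        (Set.indicator_le' (fun _ _ => le_rfl) (fun _ _ => zero_le_one) _)
  have hI0 : 0 ≤ ∫ ω, |arIER P Y n φhat α c β q₁ t ω - α| *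
      Set.indicator (Set.Icc (0 : ℝ) 1) (fun _ => (1 : ℝ)) (arThreshold Y φhat α c β q₁ t ω) ∂P :=
    integral_nonneg fun ω =>
      mul_nonneg (abs_nonneg _) (Set.indicator_nonneg (fun _ _ => zero_le_one) _)
  have hsq : ∫ ω, (|arThreshold Y φhat α c β q₁ t ω - (1 - α)| +
      arBias φ Y φhat α c β q₁ t ω) ^ 2 ∂P ≤
      2 * ∫ ω, (arThreshold Y φhat α c β q₁ t ω - (1 - α)) ^ 2 ∂P +
        2 * ∫ ω, arBias φ Y φhat α c β q₁ t ω ^ 2 ∂P := by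
    have hei : Integrable (fun ω => (arThreshold Y φhat α c β q₁ t ω - (1 - α)) ^ 2) P := by
      simpa only [sq_abs] using heL.integrable_sq
    rw [← integral_const_mul, ← integral_const_mul,
      ← integral_add (hei.const_mul 2) (hbL.integrable_sq.const_mul 2)]
    refine integral_mono (heL.add hbL).integrable_sq
      ((hei.const_mul 2).add (hbL.integrable_sq.const_mul 2)) fun ω => ?_
    dsimp only
    rw [← sq_abs (arThreshold Y φhat α c β q₁ t ω - (1 - α))]
    nlinarith [sq_nonneg (|arThreshold Y φhat α c β q₁ t ω - (1 - α)| -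
      arBias φ Y φhat α c β q₁ t ω)]
  have hfin := (pow_le_pow_left₀ hI0 hI 2).trans
    ((sq_integral_le_integral_sq (heL.add hbL)).trans hsq)
  have hp1 : (t : ℝ) ^ (-β) ≤ (t : ℝ) ^ (-β + 1 / 2) :=
    Real.rpow_le_rpow_of_exponent_le ht1' (by linarith)
  have hp2 : (t : ℝ) ^ (-(1 : ℝ)) ≤ (t : ℝ) ^ (-β + 1 / 2) :=
    Real.rpow_le_rpow_of_exponent_le ht1' (by linarith [hβ.2])
  have hp3 := mul_le_mul_of_nonneg_left hp1 hK.le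
  have hp4 := mul_le_mul_of_nonneg_left hp2 hC₁.le
  linarith

end ARProcedure

end OnlineSCI

end

theorem mainTheorem8 {Ω : Type*} [MeasurableSpace Ω] (P : Measure Ω) [IsProbabilityMeasure P]
    (d : ℕ) (hd : 1 ≤ d) (φ : EuclideanSpace ℝ (Fin d)) (Y Z : ℤ → Ω → ℝ)
    (hAR : OnlineSCI.IsStationaryAR P φ Y Z)
    (n : ℕ) (hn : d ≤ n)
    (φhat : ℕ → Ω → EuclideanSpace ℝ (Fin d))
    (hφhat : ∀ t : ℕ, 1 ≤ t → Measurable[OnlineSCI.arFiltration Y n ((t : ℤ) - 1)] (φhat t))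
    (α c β q₁ : ℝ) (hα : α ∈ Set.Ioo (0 : ℝ) 1) (hc : 0 < c) (hβ : β ∈ Set.Ioo (0 : ℝ) 1)
    (hq₁ : q₁ ∈ Set.Icc (0 : ℝ) 1) :
    (1 / 2 < β → OnlineSCI.EstimRateInProb P φ Y n φhat (3 / 2) (1 / 2) →
      ∃ T₀ : ℕ, 1 ≤ T₀ ∧ ∃ C₀ : ℝ, 0 < C₀ ∧ ∀ t : ℕ, T₀ ≤ t →
        1 - 1 / (t : ℝ) ≤
          P.real {ω | |OnlineSCI.arIER P Y n φhat α c β q₁ t ω - α| +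
              |OnlineSCI.arThreshold Y φhat α c β q₁ t ω - (1 - α)| ≤
            C₀ * (OnlineSCI.rate (1 / 2) β t +
              Real.log t ^ (3 / 2 : ℝ) * (t : ℝ) ^ (-(1 / 2) : ℝ))}) ∧
    (1 / 2 < β → OnlineSCI.EstimRateInMean P φ Y φhat 0 (1 / 2) →
      ∃ T₀ : ℕ, 1 ≤ T₀ ∧ ∃ C₀ : ℝ, 0 < C₀ ∧ ∀ t : ℕ, T₀ ≤ t →
        (∫ ω, |OnlineSCI.arIER P Y n φhat α c β q₁ t ω - α| *
            Set.indicator (Set.Icc (0 : ℝ) 1) (fun _ => (1 : ℝ))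
              (OnlineSCI.arThreshold Y φhat α c β q₁ t ω) ∂P) ^ 2 +
          ∫ ω, (OnlineSCI.arThreshold Y φhat α c β q₁ t ω - (1 - α)) ^ 2 ∂P
        ≤ C₀ * (t : ℝ) ^ (-β + 1 / 2)) := by
  exact ⟨fun hβ2 hest => OnlineSCI.exists_rate_in_probability hAR hn hφhat hα hc hβ hq₁ hβ2 hest,
    fun _ hest => OnlineSCI.exists_rate_in_expectation hAR hn hφhat hα hc hβ hq₁ hest⟩
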